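/- **Definitions.** For an interval $I\subseteq\mathbb R$ let $\mathcal S^{(\infty)}(I)$ be the set of $f\in C^\infty(I)$ such that for every $k\in\mathbb N_0$ there are $a,b,q>0$ with $|f^{(k)}(x)|\le a|x|^q+b$ for all $x\in I$. An *activation function* is a function $\varphi:\mathbb R\to\mathbb R$, not identically zero, such that $\varphi=\varphi_+$ on $(0,\infty)$ and $\varphi=\varphi_-$ on $(-\infty,0)$ with $\varphi_+\in\mathcal S^{(\infty)}((0,\infty))$, $\varphi_-\in\mathcal S^{(\infty)}((-\infty,0))$, and $\varphi(0)=\frac12\big(\lim_{x\searrow0}\varphi_+(x)+\lim_{x\nearrow0}\varphi_-(x)\big)$. Put $\Delta_k(\varphi)=\lim_{x\searrow 0}\varphi^{(k)}(x)-\lim_{x\nearrow0}\varphi^{(k)}(x)$, and for $t\in[-1,1]$ $$\widehat\varphi(t)=\mathbb E_{(u,v)\sim\mathcal N(0,\Sigma_t)}[\varphi(u)\varphi(v)],\qquad \Sigma_t=\begin{pmatrix}1&t\\t&1\end{pmatrix}.$$ For $\alpha,\beta,\gamma\in\mathbb R$ let $\mathcal P_{\alpha,\beta}$ be the set of finite sums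 $\sum_{i=1}^n a_it^{\alpha_i}$ on $(0,2)$ ($n\in\mathbb N_0$, $a_i,\alpha_i\in\mathbb R$) with $\alpha_i>\alpha$ whenever $\alpha_i\in\mathbb Z$ and $\alpha_i>\beta$ whenever $\alpha_i\notin\mathbb Z$; let $\mathcal R_\gamma$ be the set of $C^\infty$ functions $f$ on $(0,2)$ with $f^{(n)}(t)=O(t^{\gamma-n})$ as $t\searrow0$ for all $n\in\mathbb N_0$; and let $\mathcal Q_{\alpha,\beta}=\bigcap_{\gamma\in\mathbb R}(\mathcal P_{\alpha,\beta}+\mathcal R_\gamma)$. **Theorem.** For every $m\in\mathbb N_0$ there is a constant $b_m>0$, depending only on $m$, such that for every activation function $\varphi$ with $\Delta_k(\varphi)=0$ for all $k<m$, and for each $\tau\in\{1,-1\}$, the following hold. 1. There is $Q\in\mathcal Q_{-1,m+1/2}$ such that for all $t\in(0,2)$ $$\widehat\varphi(\tau(1-t))=\Delta_m(\varphi)^2(-\tau)^{m+1}b_m\,t^{m+1/2}+Q(t).$$ 2. There are a polynomial $p$ and a $C^\infty$ function $q$ on $(0,2)$ with $q^{(n)}(t)=o(t^{m+1/2-n})$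 as $t\searrow0$ for all $n\in\mathbb N_0$, such that for all $t\in(0,2)$ $$\widehat\varphi(\tau(1-t))=\Delta_m(\varphi)^2(-\tau)^{m+1}b_m\,t^{m+1/2}+p(t)+q(t).$$ -/

import Mathlib

open Set Filter Topology MeasureTheory ProbabilityTheory
open scoped ContDiff

noncomputable section

namespace DualActivation

/-- `f` is smooth on the interval `I` and each of its derivatives is polynomially bounded on `I`. -/
def SInfty (I : Set ℝ) : Set (ℝ → ℝ) :=
  {f | ContDiffOn ℝ ∞ f I ∧ ∀ k : ℕ, ∃ a b q : ℝ, 0 < a ∧ 0 < b ∧ 0 < q ∧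
    ∀ x ∈ I, |iteratedDerivWithin k f I x| ≤ a * |x| ^ q + b}

/-- Admissible activation functions: not identically zero, equal to `φp` on `(0, ∞)` and to `φm` on
`(-∞, 0)`, both smooth with polynomially bounded derivatives there, and equal at zero to the mean
of the two one-sided limits (which always exist, see `exists_jump_limits`). -/
def IsActivation (φ : ℝ → ℝ) : Prop :=
  φ ≠ 0 ∧ ∃ φp ∈ SInfty (Ioi 0), ∃ φm ∈ SInfty (Iio 0),
    (∀ x, 0 < x → φ x = φp x) ∧ (∀ x, x < 0 → φ x = φm x) ∧
    ∃ lp lm : ℝ, Tendsto φp (𝓝[>] 0) (𝓝 lp) ∧ Tendsto φm (𝓝[<] 0) (𝓝 lm) ∧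
      φ 0 = (lp + lm) / 2

/-- `Δ_k(φ)`: right-sided minus left-sided limit at zero of the `k`-th derivative of `φ`. -/
def jump (k : ℕ) (φ : ℝ → ℝ) : ℝ :=
  limUnder (𝓝[>] (0 : ℝ)) (iteratedDeriv k φ) - limUnder (𝓝[<] (0 : ℝ)) (iteratedDeriv k φ)

/-- The dual activation `t ↦ 𝔼 [φ u * φ v]` for `(u, v)` centered Gaussian with covariance matrix
`!![1, t; t, 1]`. It is of interest for `t ∈ [-1, 1]`, where this matrix is positive
semidefinite. -/
def dual (φ : ℝ → ℝ) (t : ℝ) : ℝ :=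
  ∫ x : EuclideanSpace ℝ (Fin 2), φ (x 0) * φ (x 1)
    ∂(multivariateGaussian 0 !![1, t; t, 1])

/-- Finite sums of powers on `(0, 2)`, with integer exponents larger than `α` and non-integer
exponents larger than `β`. Functions in this class (and in the two classes below) are regarded as
functions on `(0, 2)`: their values elsewhere are irrelevant. -/
def PowerSums (α β : ℝ) : Set (ℝ → ℝ) :=
  {f | ∃ (n : ℕ) (a e : Fin n → ℝ),
    (∀ i, (e i ∈ range ((↑) : ℤ → ℝ) → α < e i) ∧ (e i ∉ range ((↑) : ℤ → ℝ) → β < e i)) ∧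
    ∀ t ∈ Ioo (0 : ℝ) 2, f t = ∑ i, a i * t ^ e i}

/-- Smooth functions on `(0, 2)` whose `n`-th derivative is `O(t ^ (γ - n))` as `t ↘ 0`, for
every `n`. -/
def Remainders (γ : ℝ) : Set (ℝ → ℝ) :=
  {f | ContDiffOn ℝ ∞ f (Ioo 0 2) ∧
    ∀ n : ℕ, iteratedDeriv n f =O[𝓝[>] (0 : ℝ)] fun t : ℝ => t ^ (γ - n)}

/-- Functions that are, for every `γ`, the sum of a member of `PowerSums α β` and of a member of
`Remainders γ`. -/
def BoundaryClass (α β : ℝ) : Set (ℝ → ℝ) :=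
  {f | ∀ γ : ℝ, ∃ p ∈ PowerSums α β, ∃ r ∈ Remainders γ, ∀ t ∈ Ioo (0 : ℝ) 2, f t = p t + r t}

lemma exists_limit_of_bounded {f : ℝ → ℝ} {s : Set ℝ} {l : Filter ℝ} (hs : Convex ℝ s)
    (hso : IsOpen s) (hl : l ≤ 𝓝 0) (hsl : s ∈ l) (hs1 : ∀ x ∈ s, |x| ≤ 1)
    {I : Set ℝ} (hI : IsOpen I) (hsI : s ⊆ I) {g : ℝ → ℝ} (hg : g ∈ SInfty I)
    (hfg : EqOn f g I) (k : ℕ) : ∃ y, Tendsto (iteratedDeriv k f) l (𝓝 y) := by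
  obtain ⟨hsm, hb⟩ := hg
  obtain ⟨a, b, q, ha, hbb, hq, hbd⟩ := hb (k + 1)
  have hEq : EqOn (iteratedDeriv k f) (iteratedDerivWithin k g I) I := by
    intro x hx
    rw [iteratedDerivWithin_of_isOpen hI hx]
    exact Filter.EventuallyEq.iteratedDeriv_eq k (hfg.eventuallyEq_of_mem (hI.mem_nhds hx))
  have hdiff : DifferentiableOn ℝ (iteratedDerivWithin k g I) I :=
    hsm.differentiableOn_iteratedDerivWithin (by exact_mod_cast WithTop.coe_lt_top _)
      hI.uniqueDiffOn
  have hLip : LipschitzOnWith (Real.toNNReal (a + b)) (iteratedDerivWithin k g I) s := by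
    refine hs.lipschitzOnWith_of_nnnorm_derivWithin_le (hdiff.mono hsI) ?_
    intro x hx
    rw [derivWithin_of_isOpen hso hx, ← derivWithin_of_isOpen hI (hsI hx),
      ← iteratedDerivWithin_succ]
    rw [← NNReal.coe_le_coe, Real.coe_toNNReal _ (by positivity), coe_nnnorm, Real.norm_eq_abs]
    refine (hbd x (hsI hx)).trans ?_
    have : |x| ^ q ≤ 1 := Real.rpow_le_one (abs_nonneg x) (hs1 x hx) hq.le
    nlinarith
  obtain ⟨h, hh, hhe⟩ := hLip.extend_real
  refine ⟨h 0, ((hh.continuous.tendsto 0).mono_left hl).congr' ?_⟩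
  filter_upwards [hsl] with x hx
  rw [hEq (hsI hx), hhe hx]

/-- The one-sided limits in `jump` exist for every admissible activation function. -/
lemma exists_jump_limits {φ : ℝ → ℝ} (hφ : IsActivation φ) (k : ℕ) :
    (∃ y, Tendsto (iteratedDeriv k φ) (𝓝[>] 0) (𝓝 y)) ∧
      ∃ y, Tendsto (iteratedDeriv k φ) (𝓝[<] 0) (𝓝 y) := by
  obtain ⟨-, φp, hp, φm, hm, hep, hem, -⟩ := hφ
  refine ⟨?_, ?_⟩
  · refine exists_limit_of_bounded (convex_Ioo (0 : ℝ) 1) isOpen_Ioo nhdsWithin_le_nhds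
      (Ioo_mem_nhdsGT one_pos) ?_ isOpen_Ioi (fun x hx => hx.1) hp (fun x hx => hep x hx) k
    intro x hx
    rw [abs_le]
    constructor <;> linarith [hx.1, hx.2]
  · refine exists_limit_of_bounded (convex_Ioo (-1 : ℝ) 0) isOpen_Ioo nhdsWithin_le_nhds
      (Ioo_mem_nhdsLT (by norm_num)) ?_ isOpen_Iio (fun x hx => hx.2) hm (fun x hx => hem x hx) k
    intro x hx
    rw [abs_le]
    constructor <;> linarith [hx.1, hx.2]

end DualActivation

end

namespace DualActivation

/-! ### Symbol estimates at the left end of `(0, 2)` -/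

/-! The engine is Price's theorem with jumps. The correlated Gaussian density `p` satisfies `∂ₛ p =
∂ₓ ∂ᵧ p`. Differentiating the dual activation in the correlation `s` and integrating by parts in
both variables moves one derivative onto each copy of `φ`, and each integration leaves a boundary
term at the jump. This gives (`hasDerivAt_gaussPair`) the dual activation of `φ'`, plus `Δ₀² /
(2π√(1 - s²))`, plus a multiple of `Δ₀ · E φ'(√(1 - s²) Z)` with `Z` standard Gaussian.

For `s = τ(1 - t)` one has `1 - s² = t(2 - t)`, so the squared jump enters as `t^(-1/2)` and
integrates to `t^(1/2)`. If `Δ₀ = 0`, the derivative in `t` is just `-τ` times the dual activation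
of `φ'`, whose jumps are shifted by one. Induction on `m` (`exists_gaussPair_expansion`) then
integrates the leading term once per step, which produces `t^(m+1/2)`, the sign `(-τ)^(m+1)` and a
constant independent of `φ`.

It remains to see that everything else has a full expansion, and no asymptotics are computed for
this. The functions obtained from all piecewise smooth `φ` form a family of functions bounded near
`t = 0`, closed under differentiation up to affine factors and explicit errors. Each integration of
such a relation improves the remainder by one order (`BoundaryClass.of_derivClosed`). Boundedness up
to `|s| = 1`, where the density degenerates, comes from writing the Gaussian pair through
independent variables. -/

lemma mem_nhdsGT_zero : Ioo (0 : ℝ) 2 ∈ 𝓝[>] (0 : ℝ) := Ioo_mem_nhdsGT two_pos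

lemma iteratedDeriv_eqOn {s : Set ℝ} (hs : IsOpen s) {f g : ℝ → ℝ} (h : EqOn f g s) (n : ℕ) :
    EqOn (iteratedDeriv n f) (iteratedDeriv n g) s := fun _ hx =>
  Filter.EventuallyEq.iteratedDeriv_eq n (h.eventuallyEq_of_mem (hs.mem_nhds hx))

lemma iteratedDeriv_eventuallyEq {f g : ℝ → ℝ} (h : EqOn f g (Ioo 0 2)) (n : ℕ) :
    iteratedDeriv n f =ᶠ[𝓝[>] (0 : ℝ)] iteratedDeriv n g :=
  (iteratedDeriv_eqOn isOpen_Ioo h n).eventuallyEq_of_mem mem_nhdsGT_zero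

lemma contDiffAt_of_mem {f : ℝ → ℝ} (hf : ContDiffOn ℝ ∞ f (Ioo 0 2)) {t : ℝ}
    (ht : t ∈ Ioo (0 : ℝ) 2) (n : ℕ) : ContDiffAt ℝ n f t :=
  ((hf t ht).contDiffAt (isOpen_Ioo.mem_nhds ht)).of_le (by exact_mod_cast le_top)

lemma isBigO_rpow_of_le {a b : ℝ} (h : a ≤ b) :
    (fun t : ℝ => t ^ b) =O[𝓝[>] (0 : ℝ)] fun t : ℝ => t ^ a := by
  refine Asymptotics.IsBigO.of_bound 1 ?_
  filter_upwards [Ioo_mem_nhdsGT (one_pos : (0 : ℝ) < 1)] with t ht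
  rw [one_mul, Real.norm_of_nonneg (Real.rpow_nonneg ht.1.le _),
    Real.norm_of_nonneg (Real.rpow_nonneg ht.1.le _)]
  exact Real.rpow_le_rpow_of_exponent_ge ht.1 ht.2.le h

lemma isLittleO_rpow_of_lt {a b : ℝ} (h : a < b) :
    (fun t : ℝ => t ^ b) =o[𝓝[>] (0 : ℝ)] fun t : ℝ => t ^ a := by
  have h1 : Tendsto (fun t : ℝ => t ^ (b - a)) (𝓝[>] 0) (𝓝 0) := by
    have := (Real.continuousAt_rpow_const 0 (b - a) (Or.inr (by linarith))).tendsto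
    rw [Real.zero_rpow (by linarith)] at this
    exact this.mono_left nhdsWithin_le_nhds
  have h2 := ((Asymptotics.isLittleO_one_iff ℝ).2 h1).mul_isBigO
    (Asymptotics.isBigO_refl (fun t : ℝ => t ^ a) (𝓝[>] 0))
  refine h2.congr' ?_ ?_
  · filter_upwards [self_mem_nhdsWithin] with t ht
    rw [← Real.rpow_add ht]; simp
  · exact Eventually.of_forall fun t => one_mul _

lemma isBigO_rpow_mul {f g : ℝ → ℝ} {a b c : ℝ} (hf : f =O[𝓝[>] (0 : ℝ)] fun t : ℝ => t ^ a)
    (hg : g =O[𝓝[>] (0 : ℝ)] fun t : ℝ => t ^ b) (hc : c = a + b) :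
    (fun t => f t * g t) =O[𝓝[>] (0 : ℝ)] fun t : ℝ => t ^ c := by
  refine (hf.mul hg).congr' EventuallyEq.rfl ?_
  filter_upwards [self_mem_nhdsWithin] with t ht
  rw [hc, Real.rpow_add ht]

/-- Leibniz rule. The bounds are required only up to order `n`, so that the lemma can be used inside
an induction on the order. -/
lemma isBigO_iteratedDeriv_mul {f g : ℝ → ℝ} {a b : ℝ} (hf : ContDiffOn ℝ ∞ f (Ioo 0 2))
    (hg : ContDiffOn ℝ ∞ g (Ioo 0 2)) (n : ℕ)
    (hfO : ∀ k ≤ n, iteratedDeriv k f =O[𝓝[>] (0 : ℝ)] fun t : ℝ => t ^ (a - k))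
    (hgO : ∀ k ≤ n, iteratedDeriv k g =O[𝓝[>] (0 : ℝ)] fun t : ℝ => t ^ (b - k)) :
    iteratedDeriv n (fun t => f t * g t) =O[𝓝[>] (0 : ℝ)] fun t : ℝ => t ^ (a + b - n) := by
  have h : iteratedDeriv n (fun t => f t * g t) =ᶠ[𝓝[>] (0 : ℝ)] fun t =>
      ∑ i ∈ Finset.range (n + 1), n.choose i * (iteratedDeriv i f t * iteratedDeriv (n - i) g t) := by
    filter_upwards [mem_nhdsGT_zero] with t ht
    rw [iteratedDeriv_fun_mul (contDiffAt_of_mem hf ht n) (contDiffAt_of_mem hg ht n)]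
    simp only [mul_assoc]
  refine h.trans_isBigO (Asymptotics.IsBigO.fun_sum fun i hi => ?_)
  have hi' : i ≤ n := Nat.lt_succ_iff.1 (Finset.mem_range.1 hi)
  refine (isBigO_rpow_mul (hfO i hi') (hgO (n - i) (Nat.sub_le _ _)) ?_).const_mul_left _
  push_cast [hi']; ring

namespace Remainders

lemma congr {γ : ℝ} {f g : ℝ → ℝ} (hf : f ∈ Remainders γ) (h : EqOn g f (Ioo 0 2)) :
    g ∈ Remainders γ :=
  ⟨hf.1.congr h, fun n => (iteratedDeriv_eventuallyEq h n).trans_isBigO (hf.2 n)⟩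

lemma mono {γ δ : ℝ} (h : δ ≤ γ) {f : ℝ → ℝ} (hf : f ∈ Remainders γ) : f ∈ Remainders δ :=
  ⟨hf.1, fun n => (hf.2 n).trans (isBigO_rpow_of_le (by linarith))⟩

lemma add {γ : ℝ} {f g : ℝ → ℝ} (hf : f ∈ Remainders γ) (hg : g ∈ Remainders γ) :
    (fun t => f t + g t) ∈ Remainders γ := by
  refine ⟨hf.1.add hg.1, fun n => ?_⟩
  refine EventuallyEq.trans_isBigO ?_ ((hf.2 n).add (hg.2 n))
  filter_upwards [mem_nhdsGT_zero] with t ht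
  exact iteratedDeriv_fun_add (contDiffAt_of_mem hf.1 ht n) (contDiffAt_of_mem hg.1 ht n)

lemma mul {γ δ : ℝ} {f g : ℝ → ℝ} (hf : f ∈ Remainders γ) (hg : g ∈ Remainders δ) :
    (fun t => f t * g t) ∈ Remainders (γ + δ) :=
  ⟨hf.1.mul hg.1, fun n => isBigO_iteratedDeriv_mul hf.1 hg.1 n (fun k _ => hf.2 k)
    fun k _ => hg.2 k⟩

lemma const_mul {γ : ℝ} (c : ℝ) {f : ℝ → ℝ} (hf : f ∈ Remainders γ) :
    (fun t => c * f t) ∈ Remainders γ := by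
  refine ⟨contDiffOn_const.mul hf.1, fun n => ?_⟩
  have : iteratedDeriv n (fun t => c * f t) = fun t => c * iteratedDeriv n f t := by
    ext t; exact iteratedDeriv_const_mul_field c f
  rw [this]
  exact (hf.2 n).const_mul_left c

lemma isBigO {γ : ℝ} {f : ℝ → ℝ} (hf : f ∈ Remainders γ) :
    f =O[𝓝[>] (0 : ℝ)] fun t : ℝ => t ^ γ := by
  simpa using hf.2 0

lemma of_hasDerivAt {γ : ℝ} {f g : ℝ → ℝ} (hf : ∀ t ∈ Ioo (0 : ℝ) 2, HasDerivAt f (g t) t)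
    (hO : f =O[𝓝[>] (0 : ℝ)] fun t : ℝ => t ^ γ) (hg : g ∈ Remainders (γ - 1)) :
    f ∈ Remainders γ := by
  have hd : EqOn (deriv f) g (Ioo 0 2) := fun t ht => (hf t ht).deriv
  refine ⟨(contDiffOn_infty_iff_deriv_of_isOpen isOpen_Ioo).2
    ⟨fun t ht => (hf t ht).differentiableAt.differentiableWithinAt, hg.1.congr hd⟩, fun n => ?_⟩
  cases n with
  | zero => simpa using hO
  | succ n =>
    rw [iteratedDeriv_succ']
    refine (iteratedDeriv_eventuallyEq hd n).trans_isBigO ((hg.2 n).congr_right fun t => ?_)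
    push_cast; ring_nf

lemma rpow (e : ℝ) : (fun t : ℝ => t ^ e) ∈ Remainders e := by
  refine ⟨fun t ht => (contDiffAt_id.rpow_const_of_ne ht.1.ne').contDiffWithinAt, fun n => ?_⟩
  induction n generalizing e with
  | zero => simpa using Asymptotics.isBigO_refl _ _
  | succ n ih =>
    rw [iteratedDeriv_succ']
    have hd : EqOn (deriv fun t : ℝ => t ^ e) (fun t => e * t ^ (e - 1)) (Ioo 0 2) := fun t ht =>
      (Real.hasDerivAt_rpow_const (Or.inl ht.1.ne')).deriv
    have : iteratedDeriv n (fun t => e * t ^ (e - 1)) =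
        fun t => e * iteratedDeriv n (fun t : ℝ => t ^ (e - 1)) t := by
      ext t; exact iteratedDeriv_const_mul_field e _
    refine (iteratedDeriv_eventuallyEq hd n).trans_isBigO ?_
    rw [this]
    refine ((ih (e - 1)).congr_right fun t => ?_).const_mul_left e
    push_cast; ring_nf

lemma const_mem (c : ℝ) : (fun _ => c) ∈ Remainders 0 :=
  congr (const_mul c (Remainders.rpow 0)) fun t _ => by simp

lemma sum {ι : Type*} (s : Finset ι) {γ : ℝ} {f : ι → ℝ → ℝ} (hf : ∀ i ∈ s, f i ∈ Remainders γ) :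
    (fun t => ∑ i ∈ s, f i t) ∈ Remainders γ := by
  classical
  induction s using Finset.induction_on with
  | empty =>
    exact congr (const_mul 0 (Remainders.rpow γ)) fun t _ => by simp
  | insert a s ha ih =>
    exact congr (add (hf a (by simp)) (ih fun i hi => hf i (by simp [hi]))) fun t _ =>
      Finset.sum_insert ha

lemma zero_mem (γ : ℝ) : (fun _ => 0) ∈ Remainders γ := by
  simpa using const_mul 0 (Remainders.rpow γ)

lemma affine_mem (a b : ℝ) : (fun t : ℝ => a + b * t) ∈ Remainders 0 :=
  congr (add (const_mem a) (mono zero_le_one (const_mul b (rpow 1)))) fun t _ => by simp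

end Remainders

/-! ### Power sums -/

/-- The condition on the exponents in `PowerSums α β`. -/
def ExponentBound (α β e : ℝ) : Prop :=
  (e ∈ range ((↑) : ℤ → ℝ) → α < e) ∧ (e ∉ range ((↑) : ℤ → ℝ) → β < e)

lemma ExponentBound.mono {α β α' β' e : ℝ} (h : ExponentBound α β e) (hα : α' ≤ α) (hβ : β' ≤ β) :
    ExponentBound α' β' e :=
  ⟨fun he => hα.trans_lt (h.1 he), fun he => hβ.trans_lt (h.2 he)⟩

lemma ExponentBound.add_one {α β e : ℝ} (h : ExponentBound α β e) :
    ExponentBound (α + 1) (β + 1) (e + 1) := by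
  refine ⟨?_, fun he => ?_⟩
  · rintro ⟨k, hk⟩
    linarith [h.1 ⟨k - 1, by push_cast; linarith⟩]
  · have := h.2 fun ⟨k, hk⟩ => he ⟨k + 1, by push_cast; linarith⟩
    linarith

lemma ExponentBound.nonneg {e : ℝ} (h : ExponentBound (-1) 0 e) : 0 ≤ e := by
  by_cases he : e ∈ range ((↑) : ℤ → ℝ)
  · obtain ⟨k, rfl⟩ := he
    have hk : (-1 : ℝ) < k := h.1 ⟨k, rfl⟩
    have hk' : (-1 : ℤ) < k := by exact_mod_cast hk
    exact_mod_cast (by omega : 0 ≤ k)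
  · exact (h.2 he).le

lemma ExponentBound.lt {α e : ℝ} (h : ExponentBound α α e) : α < e :=
  (em (e ∈ range ((↑) : ℤ → ℝ))).elim h.1 h.2

namespace PowerSums

lemma of_fintype {ι : Type*} [Fintype ι] {α β : ℝ} {f : ℝ → ℝ} (a e : ι → ℝ)
    (he : ∀ i, ExponentBound α β (e i)) (h : ∀ t ∈ Ioo (0 : ℝ) 2, f t = ∑ i, a i * t ^ e i) :
    f ∈ PowerSums α β := by
  refine ⟨Fintype.card ι, a ∘ (Fintype.equivFin ι).symm, e ∘ (Fintype.equivFin ι).symm,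
    fun i => he _, fun t ht => ?_⟩
  rw [h t ht]
  exact ((Fintype.equivFin ι).symm.sum_comp fun i => a i * t ^ e i).symm

lemma monomial {α β e : ℝ} (c : ℝ) (he : ExponentBound α β e) :
    (fun t : ℝ => c * t ^ e) ∈ PowerSums α β :=
  of_fintype (fun _ : Unit => c) (fun _ => e) (fun _ => he) fun t _ => by simp

lemma add {α β : ℝ} {f g : ℝ → ℝ} (hf : f ∈ PowerSums α β) (hg : g ∈ PowerSums α β) :
    (fun t => f t + g t) ∈ PowerSums α β := by
  obtain ⟨n, a, e, he, h⟩ := hf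
  obtain ⟨n', a', e', he', h'⟩ := hg
  refine of_fintype (Sum.elim a a') (Sum.elim e e') ?_ fun t ht => ?_
  · rintro (i | i)
    exacts [he i, he' i]
  · simp [h t ht, h' t ht]

lemma mono {α β α' β' : ℝ} (hα : α' ≤ α) (hβ : β' ≤ β) {f : ℝ → ℝ} (hf : f ∈ PowerSums α β) :
    f ∈ PowerSums α' β' := by
  obtain ⟨n, a, e, he, h⟩ := hf
  exact ⟨n, a, e, fun i => ExponentBound.mono (he i) hα hβ, h⟩

lemma const_mul_rpow_mul {α β α' β' s : ℝ} (c : ℝ)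
    (hs : ∀ e, ExponentBound α β e → ExponentBound α' β' (e + s)) {f : ℝ → ℝ}
    (hf : f ∈ PowerSums α β) : (fun t => c * t ^ s * f t) ∈ PowerSums α' β' := by
  obtain ⟨n, a, e, he, h⟩ := hf
  refine ⟨n, fun i => c * a i, fun i => e i + s, fun i => hs _ (he i), fun t ht => ?_⟩
  simp only [h t ht, Finset.mul_sum]
  refine Finset.sum_congr rfl fun i _ => ?_
  rw [Real.rpow_add ht.1]; ring

lemma mem_remainders {α : ℝ} {f : ℝ → ℝ} (hf : f ∈ PowerSums α α) : f ∈ Remainders α := by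
  obtain ⟨n, a, e, he, h⟩ := hf
  exact Remainders.congr (Remainders.sum Finset.univ fun i _ =>
    Remainders.mono (ExponentBound.lt (he i)).le
      (Remainders.const_mul (a i) (Remainders.rpow (e i)))) h

/-- The integer threshold `-1` excludes the exponent `-1` itself, so termwise integration never
produces a logarithm. -/
lemma exists_antideriv {β : ℝ} {f : ℝ → ℝ} (hf : f ∈ PowerSums (-1) β) :
    ∃ F ∈ PowerSums 0 (β + 1), ∀ t ∈ Ioo (0 : ℝ) 2, HasDerivAt F (f t) t := by
  obtain ⟨n, a, e, he, h⟩ := hf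
  refine ⟨fun t => ∑ i, a i / (e i + 1) * t ^ (e i + 1), ⟨n, _, _, fun i => ?_, fun t _ => rfl⟩,
    fun t ht => ?_⟩
  · have := ExponentBound.add_one (he i)
    rwa [neg_add_cancel] at this
  · rw [h t ht]
    refine HasDerivAt.fun_sum fun i _ => ?_
    have hne : e i + 1 ≠ 0 := fun h0 => by
      have h1 : e i = ((-1 : ℤ) : ℝ) := by push_cast; linarith
      have := (he i).1 ⟨-1, h1.symm⟩
      push_cast at h1
      linarith
    refine ((Real.hasDerivAt_rpow_const (Or.inl ht.1.ne')).const_mul (a i / (e i + 1))).congr_deriv ?_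
    rw [add_sub_cancel_right]
    field_simp

end PowerSums

/-! ### Expansions up to a remainder -/

/-- Functions with an expansion by a member of `PowerSums α β` up to `Remainders γ`. -/
def Expansions (γ α β : ℝ) : Set (ℝ → ℝ) :=
  {f | ∃ p ∈ PowerSums α β, ∃ r ∈ Remainders γ, ∀ t ∈ Ioo (0 : ℝ) 2, f t = p t + r t}

namespace Expansions

lemma congr {γ α β : ℝ} {f g : ℝ → ℝ} (hf : f ∈ Expansions γ α β) (h : EqOn g f (Ioo 0 2)) :
    g ∈ Expansions γ α β := by
  obtain ⟨p, hp, r, hr, hpr⟩ := hf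
  exact ⟨p, hp, r, hr, fun t ht => (h ht).trans (hpr t ht)⟩

lemma mono {γ α β γ' α' β' : ℝ} (hγ : γ' ≤ γ) (hα : α' ≤ α) (hβ : β' ≤ β) {f : ℝ → ℝ}
    (hf : f ∈ Expansions γ α β) : f ∈ Expansions γ' α' β' := by
  obtain ⟨p, hp, r, hr, hpr⟩ := hf
  exact ⟨p, PowerSums.mono hα hβ hp, r, Remainders.mono hγ hr, hpr⟩

lemma add {γ α β : ℝ} {f g : ℝ → ℝ} (hf : f ∈ Expansions γ α β) (hg : g ∈ Expansions γ α β) :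
    (fun t => f t + g t) ∈ Expansions γ α β := by
  obtain ⟨p, hp, r, hr, hpr⟩ := hf
  obtain ⟨p', hp', r', hr', hpr'⟩ := hg
  exact ⟨_, PowerSums.add hp hp', _, Remainders.add hr hr', fun t ht => by
    simp only [hpr t ht, hpr' t ht]; ring⟩

lemma const_mul_rpow_mul {γ α β γ' α' β' s : ℝ} (c : ℝ)
    (hs : ∀ e, ExponentBound α β e → ExponentBound α' β' (e + s)) (hγ : γ' ≤ γ + s) {f : ℝ → ℝ}
    (hf : f ∈ Expansions γ α β) : (fun t => c * t ^ s * f t) ∈ Expansions γ' α' β' := by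
  obtain ⟨p, hp, r, hr, hpr⟩ := hf
  refine ⟨_, PowerSums.const_mul_rpow_mul c hs hp, fun t => c * t ^ s * r t, ?_, fun t ht => ?_⟩
  · exact Remainders.mono (by linarith)
      (Remainders.mul (Remainders.const_mul c (Remainders.rpow s)) hr)
  · simp only [hpr t ht]; ring

lemma const_mul {γ α β : ℝ} (c : ℝ) {f : ℝ → ℝ} (hf : f ∈ Expansions γ α β) :
    (fun t => c * f t) ∈ Expansions γ α β := by
  simpa using const_mul_rpow_mul (s := 0) c (fun e he => by simpa using he) (by simp) hf

lemma affine_mul {γ α β : ℝ} (a b : ℝ) {f : ℝ → ℝ} (hf : f ∈ Expansions γ α β) :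
    (fun t => (a + b * t) * f t) ∈ Expansions γ α β := by
  have := add (const_mul a hf) (const_mul_rpow_mul (s := 1) (γ' := γ) (α' := α) (β' := β) b
    (fun e he => (ExponentBound.add_one he).mono (by linarith) (by linarith)) (by linarith) hf)
  refine congr this fun t _ => ?_
  simp only [Real.rpow_one]; ring

lemma contDiffOn {γ α β : ℝ} {f : ℝ → ℝ} (hf : f ∈ Expansions γ α β) :
    ContDiffOn ℝ ∞ f (Ioo 0 2) := by
  obtain ⟨p, ⟨n, a, e, -, h⟩, r, hr, hpr⟩ := hf
  refine ContDiffOn.congr (f := fun t => (∑ i, a i * t ^ e i) + r t) (ContDiffOn.add ?_ hr.1)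
    fun t ht => by rw [hpr t ht, h t ht]
  exact ContDiffOn.sum fun i _ => contDiffOn_const.mul (Remainders.rpow (e i)).1

lemma mem_remainders {α : ℝ} {f : ℝ → ℝ} (hf : f ∈ Expansions α α α) : f ∈ Remainders α := by
  obtain ⟨p, hp, r, hr, hpr⟩ := hf
  exact Remainders.congr (Remainders.add (PowerSums.mem_remainders hp) hr) hpr

end Expansions

/-! ### Integration of expansions -/

/-- A function whose derivative is `O(t ^ γ)` with `γ ≥ 0` is a constant up to
`O(t ^ (γ + 1))`. -/
lemma exists_isBigO_sub_const {γ : ℝ} (hγ : 0 ≤ γ) {f g : ℝ → ℝ}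
    (hf : ∀ t ∈ Ioo (0 : ℝ) 2, HasDerivAt f (g t) t)
    (hg : g =O[𝓝[>] (0 : ℝ)] fun t : ℝ => t ^ γ) :
    ∃ c, (fun t => f t - c) =O[𝓝[>] (0 : ℝ)] fun t : ℝ => t ^ (γ + 1) := by
  obtain ⟨C, hC0, hC⟩ := hg.exists_nonneg
  obtain ⟨δ, hδ, hδC⟩ := mem_nhdsGT_iff_exists_Ioo_subset.1 (inter_mem mem_nhdsGT_zero hC.bound)
  have hδ0 : (0 : ℝ) < δ := hδ
  have key : ∀ s ∈ Ioo 0 δ, ∀ t ∈ Ioo 0 δ, s ≤ t → |f t - f s| ≤ C * t ^ γ * |t - s| := by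
    intro s hs t ht hst
    have := (convex_Icc s t).norm_image_sub_le_of_norm_hasDerivWithin_le (f := f) (f' := g)
      (C := C * t ^ γ)
      (fun x hx => (hf x (hδC ⟨hs.1.trans_le hx.1, hx.2.trans_lt ht.2⟩).1).hasDerivWithinAt)
      (fun x hx => ?_) (left_mem_Icc.2 hst) (right_mem_Icc.2 hst)
    · simpa using this
    · have hx0 : 0 < x := hs.1.trans_le hx.1
      refine ((hδC ⟨hx0, hx.2.trans_lt ht.2⟩).2 : ‖g x‖ ≤ C * ‖x ^ γ‖).trans ?_
      rw [Real.norm_of_nonneg (Real.rpow_nonneg hx0.le _)]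
      exact mul_le_mul_of_nonneg_left (Real.rpow_le_rpow hx0.le hx.2 hγ) hC0
  -- `f` is Lipschitz near zero, hence has a limit there; this limit is the constant. The rate
  -- follows by letting `s ↘ 0` in `key`.
  have hLip : LipschitzOnWith (Real.toNNReal (C * δ ^ γ)) f (Ioo 0 δ) := by
    refine LipschitzOnWith.of_dist_le_mul fun x hx y hy => ?_
    rw [Real.coe_toNNReal _ (by positivity)]
    wlog hxy : y ≤ x generalizing x y
    · rw [dist_comm, dist_comm x]; exact this y hy x hx (by linarith)
    refine (key y hy x hx hxy).trans ?_
    rw [Real.dist_eq]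
    gcongr
    exacts [hx.1.le, hx.2.le]
  obtain ⟨h, hh, hhe⟩ := hLip.extend_real
  have hlim : Tendsto f (𝓝[>] 0) (𝓝 (h 0)) := by
    refine ((hh.continuous.tendsto 0).mono_left nhdsWithin_le_nhds).congr' ?_
    filter_upwards [Ioo_mem_nhdsGT hδ0] with x hx using (hhe hx).symm
  refine ⟨h 0, Asymptotics.IsBigO.of_bound C ?_⟩
  filter_upwards [Ioo_mem_nhdsGT hδ0] with t ht
  rw [Real.norm_of_nonneg (Real.rpow_nonneg ht.1.le _), Real.rpow_add_one ht.1.ne', ← mul_assoc]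
  have h1 : Tendsto (fun s => ‖f t - f s‖) (𝓝[>] 0) (𝓝 ‖f t - h 0‖) :=
    (tendsto_const_nhds.sub hlim).norm
  refine le_of_tendsto h1 ?_
  filter_upwards [Ioo_mem_nhdsGT ht.1] with s hs
  refine (key s ⟨hs.1, hs.2.trans ht.2⟩ t ht hs.2.le).trans ?_
  have := Real.rpow_nonneg ht.1.le γ
  rw [abs_of_pos (sub_pos.2 hs.2)]
  gcongr
  linarith [hs.1]

/-- The constant of integration is a term `t ^ 0`. Its exponent is an integer above `-1`, so it is
admitted however large `β` is; this is why integer and non-integer exponents carry separate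
thresholds. -/
lemma Expansions.of_hasDerivAt {γ β : ℝ} (hγ : 0 ≤ γ) {f g : ℝ → ℝ}
    (hf : ∀ t ∈ Ioo (0 : ℝ) 2, HasDerivAt f (g t) t) (hg : g ∈ Expansions γ (-1) β) :
    f ∈ Expansions (γ + 1) (-1) (β + 1) := by
  obtain ⟨p, hp, r, hr, hpr⟩ := hg
  obtain ⟨P, hP, hPd⟩ := PowerSums.exists_antideriv hp
  have hd : ∀ t ∈ Ioo (0 : ℝ) 2, HasDerivAt (fun t => f t - P t) (r t) t := fun t ht =>
    ((hf t ht).sub (hPd t ht)).congr_deriv (by rw [hpr t ht]; ring)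
  obtain ⟨c, hc⟩ := exists_isBigO_sub_const hγ hd (Remainders.isBigO hr)
  refine ⟨fun t => P t + c, ?_, fun t => f t - P t - c,
    Remainders.of_hasDerivAt (fun t ht => (hd t ht).sub_const c) hc (by simpa using hr),
    fun t _ => by ring⟩
  have h0 : ExponentBound (-1) (β + 1) 0 := ⟨fun _ => by norm_num, fun h => (h ⟨0, by simp⟩).elim⟩
  simpa using PowerSums.add (PowerSums.mono (by norm_num) le_rfl hP) (PowerSums.monomial c h0)

lemma BoundaryClass.of_hasDerivAt {β : ℝ} {f g : ℝ → ℝ}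
    (hf : ∀ t ∈ Ioo (0 : ℝ) 2, HasDerivAt f (g t) t) (hg : g ∈ BoundaryClass (-1) β) :
    f ∈ BoundaryClass (-1) (β + 1) := fun γ =>
  Expansions.mono (by linarith [le_max_left γ 0]) le_rfl le_rfl
    (Expansions.of_hasDerivAt (le_max_right γ 0) hf (hg (max γ 0)))

/-! ### The boundary class and the bootstrap argument -/

namespace BoundaryClass

lemma congr {α β : ℝ} {f g : ℝ → ℝ} (hf : f ∈ BoundaryClass α β) (h : EqOn g f (Ioo 0 2)) :
    g ∈ BoundaryClass α β := fun γ => Expansions.congr (hf γ) h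

lemma mono {α β α' β' : ℝ} (hα : α' ≤ α) (hβ : β' ≤ β) {f : ℝ → ℝ}
    (hf : f ∈ BoundaryClass α β) : f ∈ BoundaryClass α' β' := fun γ =>
  Expansions.mono le_rfl hα hβ (hf γ)

lemma add {α β : ℝ} {f g : ℝ → ℝ} (hf : f ∈ BoundaryClass α β) (hg : g ∈ BoundaryClass α β) :
    (fun t => f t + g t) ∈ BoundaryClass α β := fun γ => Expansions.add (hf γ) (hg γ)

lemma const_mul {α β : ℝ} (c : ℝ) {f : ℝ → ℝ} (hf : f ∈ BoundaryClass α β) :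
    (fun t => c * f t) ∈ BoundaryClass α β := fun γ => Expansions.const_mul c (hf γ)

lemma affine_mul {α β : ℝ} (a b : ℝ) {f : ℝ → ℝ} (hf : f ∈ BoundaryClass α β) :
    (fun t => (a + b * t) * f t) ∈ BoundaryClass α β := fun γ => Expansions.affine_mul a b (hf γ)

lemma rpow_mul {α β α' β' : ℝ} (s : ℝ)
    (hs : ∀ e, ExponentBound α β e → ExponentBound α' β' (e + s)) {f : ℝ → ℝ}
    (hf : f ∈ BoundaryClass α β) : (fun t => t ^ s * f t) ∈ BoundaryClass α' β' := fun γ =>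
  Expansions.congr (Expansions.const_mul_rpow_mul (γ' := γ) 1 hs (by linarith) (hf (γ - s)))
    fun t _ => by rw [one_mul]

lemma zero_mem (α β : ℝ) : (fun _ => 0) ∈ BoundaryClass α β := fun γ =>
  ⟨fun _ => 0, ⟨0, fun _ => 0, fun _ => 0, fun i => i.elim0, fun t _ => by simp⟩, fun _ => 0,
    Remainders.zero_mem γ, fun t _ => by simp⟩

lemma contDiffOn {α β : ℝ} {f : ℝ → ℝ} (hf : f ∈ BoundaryClass α β) :
    ContDiffOn ℝ ∞ f (Ioo 0 2) := Expansions.contDiffOn (hf 0)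

/-- A family of functions bounded near zero, which is closed under differentiation up to
affine factors and summands in the boundary class, lies in the boundary class. -/
lemma of_derivClosed (C : Set (ℝ → ℝ)) (hB : ∀ f ∈ C, f =O[𝓝[>] (0 : ℝ)] fun _ => (1 : ℝ))
    (hD : ∀ f ∈ C, ∃ g ∈ C, ∃ E ∈ BoundaryClass (-1) (-1), ∃ a b : ℝ, ∀ t ∈ Ioo (0 : ℝ) 2,
      HasDerivAt f ((a + b * t) * g t + E t) t) {f : ℝ → ℝ} (hf : f ∈ C) :
    f ∈ BoundaryClass (-1) 0 := by
  have hcd : ∀ n : ℕ, ∀ f ∈ C, ContDiffOn ℝ n f (Ioo 0 2) := by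
    intro n
    induction n with
    | zero =>
      intro f hf
      obtain ⟨g, -, E, -, a, b, h⟩ := hD f hf
      exact contDiffOn_zero.2 fun t ht => (h t ht).continuousAt.continuousWithinAt
    | succ n ih =>
      intro f hf
      obtain ⟨g, hg, E, hE, a, b, h⟩ := hD f hf
      push_cast
      refine (contDiffOn_succ_iff_deriv_of_isOpen isOpen_Ioo).2
        ⟨fun t ht => (h t ht).differentiableAt.differentiableWithinAt, by simp, ?_⟩
      refine ContDiffOn.congr (f := fun t => (a + b * t) * g t + E t) ?_ fun t ht => (h t ht).deriv
      exact ((by fun_prop : ContDiffOn ℝ n (fun t : ℝ => a + b * t) (Ioo 0 2)).mul (ih g hg)).add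
        ((contDiffOn hE).of_le (by exact_mod_cast le_top))
  have hsm : ∀ f ∈ C, ContDiffOn ℝ ∞ f (Ioo 0 2) := fun f hf =>
    contDiffOn_infty.2 fun n => hcd n f hf
  -- All orders up to `n` and the whole family are treated together, since the Leibniz rule calls
  -- for every lower derivative of `g`. The error `E` contributes `t ^ (-1 - n)`, which is exactly
  -- what order `n + 1` allows.
  have hO : ∀ n : ℕ, ∀ k ≤ n, ∀ f ∈ C,
      iteratedDeriv k f =O[𝓝[>] (0 : ℝ)] fun t : ℝ => t ^ (0 - (k : ℝ)) := by
    intro n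
    induction n with
    | zero =>
      intro k hk f hf
      obtain rfl : k = 0 := by omega
      simpa using hB f hf
    | succ n ih =>
      intro k hk f hf
      rcases Nat.lt_or_ge k (n + 1) with h | h
      · exact ih k (by omega) f hf
      obtain rfl : k = n + 1 := le_antisymm hk h
      obtain ⟨g, hg, E, hE, a, b, h⟩ := hD f hf
      rw [iteratedDeriv_succ']
      have hd : EqOn (deriv f) (fun t => (a + b * t) * g t + E t) (Ioo 0 2) := fun t ht =>
        (h t ht).deriv
      refine (iteratedDeriv_eventuallyEq hd n).trans_isBigO ?_
      have h1 : ContDiffOn ℝ ∞ (fun t => (a + b * t) * g t) (Ioo 0 2) :=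
        (Remainders.affine_mem a b).1.mul (hsm g hg)
      have h2 : iteratedDeriv n (fun t => (a + b * t) * g t + E t) =ᶠ[𝓝[>] (0 : ℝ)]
          fun t => iteratedDeriv n (fun t => (a + b * t) * g t) t + iteratedDeriv n E t := by
        filter_upwards [mem_nhdsGT_zero] with t ht
        exact iteratedDeriv_fun_add (contDiffAt_of_mem h1 ht n)
          (contDiffAt_of_mem (contDiffOn hE) ht n)
      refine h2.trans_isBigO (Asymptotics.IsBigO.add ?_ ?_)
      · refine (isBigO_iteratedDeriv_mul (Remainders.affine_mem a b).1 (hsm g hg) n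
          (fun k _ => (Remainders.affine_mem a b).2 k)
          fun k hk => ih k hk g hg).trans (isBigO_rpow_of_le ?_)
        push_cast; linarith
      · refine ((Expansions.mem_remainders (hE (-1))).2 n).trans (isBigO_rpow_of_le ?_)
        push_cast; linarith
  -- Bootstrap: at order zero `f` is its own remainder; each integration of the derivative relation
  -- gains one order and raises the non-integer threshold from `-1` to `0`.
  have hN : ∀ N : ℕ, ∀ f ∈ C, f ∈ Expansions N (-1) 0 := by
    intro N
    induction N with
    | zero =>
      intro f hf
      exact ⟨fun _ => 0, ⟨0, fun _ => 0, fun _ => 0, fun i => i.elim0, fun t _ => by simp⟩, f,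
        ⟨hsm f hf, fun n => by simpa using hO n n le_rfl f hf⟩, fun t _ => by simp⟩
    | succ N ih =>
      intro f hf
      obtain ⟨g, hg, E, hE, a, b, h⟩ := hD f hf
      have := Expansions.of_hasDerivAt (β := -1) N.cast_nonneg h
        (Expansions.add (Expansions.affine_mul a b
          (Expansions.mono le_rfl le_rfl (by norm_num) (ih g hg))) (hE N))
      exact Expansions.mono (by simp) le_rfl (by norm_num) this
  intro γ
  obtain ⟨N, hNγ⟩ := exists_nat_ge γ
  exact Expansions.mono hNγ le_rfl le_rfl (hN N f hf)

/-- The expansion of a function which tends to zero has no constant term. -/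
lemma of_tendsto_zero {f : ℝ → ℝ} (hf : f ∈ BoundaryClass (-1) 0)
    (h0 : Tendsto f (𝓝[>] 0) (𝓝 0)) : f ∈ BoundaryClass 0 0 := by
  intro γ
  -- The order is at least `1`, so that the remainder vanishes at zero even for negative `γ`.
  obtain ⟨p, ⟨n, a, e, he, hp⟩, r, hr, hpr⟩ := hf (max γ 1)
  have hr0 : Tendsto r (𝓝[>] 0) (𝓝 0) := by
    have := (Remainders.isBigO hr).trans_isLittleO (isLittleO_rpow_of_lt (a := 0) (by simp : 0 < max γ 1))
    simpa using this
  have he0 : ∀ i, 0 ≤ e i := fun i => ExponentBound.nonneg (he i)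
  -- Constant terms are replaced by `0 * t ^ 1`: the index set stays the same and all exponents
  -- become positive.
  set p' : ℝ → ℝ := fun t => ∑ i, (if e i = 0 then 0 else a i) * t ^ (if e i = 0 then 1 else e i)
    with hp'
  have hpos : ∀ i, 0 < (if e i = 0 then 1 else e i) := fun i => by
    split_ifs with h
    · exact one_pos
    · exact (he0 i).lt_of_ne' h
  have hp'0 : Tendsto p' (𝓝[>] 0) (𝓝 0) := by
    have : (0 : ℝ) = ∑ i, (if e i = 0 then 0 else a i) * 0 := by simp
    rw [this]
    refine tendsto_finsetSum _ fun i _ => Tendsto.const_mul _ ?_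
    have := isLittleO_rpow_of_lt (hpos i)
    simpa using this
  have hsplit : ∀ t ∈ Ioo (0 : ℝ) 2, f t = (∑ i, if e i = 0 then a i else 0) + (p' t + r t) := by
    intro t ht
    rw [hpr t ht, hp t ht, hp', ← add_assoc, ← Finset.sum_add_distrib]
    congr 1
    refine Finset.sum_congr rfl fun i _ => ?_
    split_ifs with h <;> simp [h]
  have hA : (∑ i, if e i = 0 then a i else 0) = 0 := by
    have h1 : Tendsto f (𝓝[>] 0) (𝓝 ((∑ i, if e i = 0 then a i else 0) + (0 + 0))) :=
      (tendsto_const_nhds.add (hp'0.add hr0)).congr' (by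
        filter_upwards [mem_nhdsGT_zero] with t ht using (hsplit t ht).symm)
    simpa using tendsto_nhds_unique h1 h0
  refine ⟨p', ⟨n, _, _, fun i => ⟨fun _ => hpos i, fun _ => hpos i⟩, fun t _ => rfl⟩, r,
    Remainders.mono (le_max_left _ _) hr, fun t ht => ?_⟩
  rw [hsplit t ht, hA, zero_add]

end BoundaryClass

/-! ### Powers of `2 - t` and of `t * (2 - t)` -/

lemma two_sub_rpow_mem_boundaryClass (e : ℝ) :
    (fun t : ℝ => (2 - t) ^ e) ∈ BoundaryClass (-1) 0 := by
  refine BoundaryClass.of_derivClosed (range fun e : ℝ => fun t : ℝ => (2 - t) ^ e) ?_ ?_ ⟨e, rfl⟩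
  · rintro _ ⟨e, rfl⟩
    have : ContinuousAt (fun t : ℝ => (2 - t) ^ e) 0 :=
      (continuousAt_const.sub continuousAt_id).rpow_const (Or.inl (by norm_num))
    exact (this.tendsto.mono_left nhdsWithin_le_nhds).isBigO_one ℝ
  · rintro _ ⟨e, rfl⟩
    refine ⟨_, ⟨e - 1, rfl⟩, _, BoundaryClass.zero_mem _ _, -e, 0, fun t ht => ?_⟩
    have := ((hasDerivAt_id t).const_sub 2).rpow_const (p := e) (Or.inl (by simp; linarith [ht.2]))
    exact this.congr_deriv (by simp)

lemma rpow_neg_half_mul_mem_boundaryClass :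
    (fun t : ℝ => (t * (2 - t)) ^ (-(1 / 2) : ℝ)) ∈ BoundaryClass (-1) (-1) := by
  refine BoundaryClass.congr (BoundaryClass.rpow_mul (-(1 / 2)) (α' := -1) (β' := -1) (fun e he => ?_)
    (two_sub_rpow_mem_boundaryClass (-(1 / 2)))) fun t ht => ?_
  · have := he.nonneg
    exact ⟨fun _ => by linarith, fun _ => by linarith⟩
  · exact Real.mul_rpow ht.1.le (by linarith [ht.2])

/-- `(2 - t)^(-1/2) - 2^(-1/2)` vanishes at zero, so its expansion has only positive exponents; the
factor `t^(-1/2)` then leaves exponents above `-1/2`. -/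
lemma rpow_neg_half_mul_sub_mem_boundaryClass :
    (fun t : ℝ => (t * (2 - t)) ^ (-(1 / 2) : ℝ) - 2 ^ (-(1 / 2) : ℝ) * t ^ (-(1 / 2) : ℝ)) ∈
      BoundaryClass (-1) (-(1 / 2)) := by
  have h1 : (fun t : ℝ => (2 - t) ^ (-(1 / 2) : ℝ) + -2 ^ (-(1 / 2) : ℝ)) ∈ BoundaryClass 0 0 := by
    refine BoundaryClass.of_tendsto_zero (BoundaryClass.add (two_sub_rpow_mem_boundaryClass _) ?_) ?_
    · intro γ
      refine ⟨_, PowerSums.monomial (e := 0) (-2 ^ (-(1 / 2) : ℝ))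
        ⟨fun _ => by norm_num, fun h => (h ⟨0, by simp⟩).elim⟩, fun _ => 0,
        Remainders.zero_mem γ, fun t _ => by simp⟩
    · have : ContinuousAt (fun t : ℝ => (2 - t) ^ (-(1 / 2) : ℝ) + -2 ^ (-(1 / 2) : ℝ)) 0 :=
        ((continuousAt_const.sub continuousAt_id).rpow_const (Or.inl (by norm_num))).add
          continuousAt_const
      simpa using this.tendsto.mono_left nhdsWithin_le_nhds
  refine BoundaryClass.congr (BoundaryClass.rpow_mul (-(1 / 2)) (α' := -1) (β' := -(1 / 2))
    (fun e he => ?_) h1) fun t ht => ?_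
  · have := ExponentBound.lt he
    exact ⟨fun _ => by linarith, fun _ => by linarith⟩
  · rw [Real.mul_rpow ht.1.le (by linarith [ht.2])]; ring

/-! ### Piecewise smooth functions -/

/-- Functions which are smooth with polynomially bounded derivatives on both open half lines. -/
def PiecewiseSmooth (φ : ℝ → ℝ) : Prop := φ ∈ SInfty (Ioi 0) ∧ φ ∈ SInfty (Iio 0)

lemma SInfty.congr {I : Set ℝ} {f g : ℝ → ℝ} (hf : f ∈ SInfty I) (h : EqOn g f I) :
    g ∈ SInfty I := by
  refine ⟨hf.1.congr h, fun k => ?_⟩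
  obtain ⟨a, b, q, ha, hb, hq, hbd⟩ := hf.2 k
  refine ⟨a, b, q, ha, hb, hq, fun x hx => ?_⟩
  rw [iteratedDerivWithin_congr h hx]
  exact hbd x hx

lemma SInfty.deriv {I : Set ℝ} (hI : IsOpen I) {f : ℝ → ℝ} (hf : f ∈ SInfty I) :
    deriv f ∈ SInfty I := by
  refine ⟨((contDiffOn_infty_iff_deriv_of_isOpen hI).1 hf.1).2, fun k => ?_⟩
  obtain ⟨a, b, q, ha, hb, hq, hbd⟩ := hf.2 (k + 1)
  refine ⟨a, b, q, ha, hb, hq, fun x hx => ?_⟩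
  have := hbd x hx
  rwa [iteratedDerivWithin_of_isOpen hI hx, iteratedDeriv_succ',
    ← iteratedDerivWithin_of_isOpen hI hx] at this

lemma SInfty.exists_pow_bound {I : Set ℝ} {f : ℝ → ℝ} (hf : f ∈ SInfty I) :
    ∃ (C : ℝ) (N : ℕ), 0 ≤ C ∧ ∀ x ∈ I, |f x| ≤ C * (1 + |x|) ^ N := by
  obtain ⟨a, b, q, ha, hb, hq, hbd⟩ := hf.2 0
  obtain ⟨N, hN⟩ := exists_nat_ge q
  refine ⟨a + b, N, by positivity, fun x hx => ?_⟩
  have h1 : |x| ^ q ≤ (1 + |x|) ^ N := by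
    rw [← Real.rpow_natCast]
    exact (Real.rpow_le_rpow (abs_nonneg x) (by linarith) hq.le).trans
      (Real.rpow_le_rpow_of_exponent_le (by linarith [abs_nonneg x]) hN)
  have h2 : 1 ≤ (1 + |x|) ^ N := one_le_pow₀ (by linarith [abs_nonneg x])
  have := hbd x hx
  rw [iteratedDerivWithin_zero] at this
  nlinarith

lemma IsActivation.piecewiseSmooth {φ : ℝ → ℝ} (hφ : IsActivation φ) : PiecewiseSmooth φ := by
  obtain ⟨-, φp, hp, φm, hm, hep, hem, -⟩ := hφ
  exact ⟨SInfty.congr hp hep, SInfty.congr hm hem⟩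

namespace PiecewiseSmooth

variable {φ : ℝ → ℝ}

protected lemma deriv (hφ : PiecewiseSmooth φ) : PiecewiseSmooth (deriv φ) :=
  ⟨SInfty.deriv isOpen_Ioi hφ.1, SInfty.deriv isOpen_Iio hφ.2⟩

lemma hasDerivAt (hφ : PiecewiseSmooth φ) {x : ℝ} (hx : x ≠ 0) : HasDerivAt φ (deriv φ x) x := by
  rcases hx.lt_or_gt with h | h
  · exact ((hφ.2.1.differentiableOn (by simp)).differentiableAt (isOpen_Iio.mem_nhds h)).hasDerivAt
  · exact ((hφ.1.1.differentiableOn (by simp)).differentiableAt (isOpen_Ioi.mem_nhds h)).hasDerivAt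

lemma measurable (hφ : PiecewiseSmooth φ) : Measurable φ :=
  measurable_of_continuousOn_compl_singleton 0 fun _ hx =>
    (hφ.hasDerivAt hx).continuousAt.continuousWithinAt

lemma exists_pow_bound (hφ : PiecewiseSmooth φ) :
    ∃ (C : ℝ) (N : ℕ), 0 ≤ C ∧ ∀ x, |φ x| ≤ C * (1 + |x|) ^ N := by
  obtain ⟨C, N, hC, h⟩ := SInfty.exists_pow_bound hφ.1
  obtain ⟨C', N', hC', h'⟩ := SInfty.exists_pow_bound hφ.2
  refine ⟨C + C' + |φ 0|, N + N', by positivity, fun x => ?_⟩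
  have h1 : (1 : ℝ) ≤ 1 + |x| := by linarith [abs_nonneg x]
  have hN : (1 + |x|) ^ N ≤ (1 + |x|) ^ (N + N') := pow_le_pow_right₀ h1 (by omega)
  have hN' : (1 + |x|) ^ N' ≤ (1 + |x|) ^ (N + N') := pow_le_pow_right₀ h1 (by omega)
  have h3 : 1 ≤ (1 + |x|) ^ (N + N') := one_le_pow₀ h1
  have h4 := abs_nonneg (φ 0)
  rcases lt_trichotomy x 0 with hx | rfl | hx
  · refine (h' x hx).trans ?_
    gcongr ?_ * ?_
    linarith
  · nlinarith
  · refine (h x hx).trans ?_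
    gcongr ?_ * ?_
    linarith

lemma tendsto_right (hφ : PiecewiseSmooth φ) :
    Tendsto φ (𝓝[>] 0) (𝓝 (limUnder (𝓝[>] (0 : ℝ)) φ)) := by
  refine tendsto_nhds_limUnder ?_
  have := exists_limit_of_bounded (convex_Ioo (0 : ℝ) 1) isOpen_Ioo nhdsWithin_le_nhds
    (Ioo_mem_nhdsGT one_pos) (fun x hx => abs_le.2 ⟨by linarith [hx.1], hx.2.le⟩) isOpen_Ioi
    (fun x hx => hx.1) hφ.1 (fun x _ => rfl) 0
  simpa using this

lemma tendsto_left (hφ : PiecewiseSmooth φ) :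
    Tendsto φ (𝓝[<] 0) (𝓝 (limUnder (𝓝[<] (0 : ℝ)) φ)) := by
  refine tendsto_nhds_limUnder ?_
  have := exists_limit_of_bounded (convex_Ioo (-1 : ℝ) 0) isOpen_Ioo nhdsWithin_le_nhds
    (Ioo_mem_nhdsLT (by norm_num)) (fun x hx => abs_le.2 ⟨hx.1.le, by linarith [hx.2]⟩) isOpen_Iio
    (fun x hx => hx.2) hφ.2 (fun x _ => rfl) 0
  simpa using this

lemma _root_.DualActivation.jump_succ (k : ℕ) (φ : ℝ → ℝ) : jump (k + 1) φ = jump k (deriv φ) := by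
  simp only [jump, iteratedDeriv_succ']

/-- Integration by parts against a function with a jump at zero. -/
lemma integral_mul_deriv (hφ : PiecewiseSmooth φ) {g g' : ℝ → ℝ} (hg : ∀ x, HasDerivAt g (g' x) x)
    (h1 : Integrable fun x => φ x * g' x) (h2 : Integrable fun x => deriv φ x * g x)
    (h3 : Integrable fun x => φ x * g x) :
    ∫ x, φ x * g' x = -jump 0 φ * g 0 - ∫ x, deriv φ x * g x := by
  have hd : ∀ x ≠ 0, HasDerivAt (fun x => φ x * g x) (deriv φ x * g x + φ x * g' x) x :=
    fun x hx => (hφ.hasDerivAt hx).mul (hg x)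
  have hg0 := (hg 0).continuousAt.tendsto
  -- On each half line the boundary term at infinity vanishes because the product and its derivative
  -- are integrable; the two one-sided terms at zero combine to the jump.
  have hR := integral_Ioi_mul_deriv_eq_deriv_mul (u := φ) (v := g) (a := 0)
    (fun x hx => hφ.hasDerivAt (ne_of_gt hx)) (fun x _ => hg x) h1.integrableOn h2.integrableOn
    (hφ.tendsto_right.mul (hg0.mono_left nhdsWithin_le_nhds))
    (tendsto_zero_of_hasDerivAt_of_integrableOn_Ioi (a := 0)
      (fun x hx => hd x (ne_of_gt hx)) (h2.add h1).integrableOn h3.integrableOn)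
  have hL := integral_Iic_mul_deriv_eq_deriv_mul (u := φ) (v := g) (a := 0)
    (fun x hx => hφ.hasDerivAt (ne_of_lt hx)) (fun x _ => hg x) h1.integrableOn h2.integrableOn
    (hφ.tendsto_left.mul (hg0.mono_left nhdsWithin_le_nhds))
    -- The half line is closed here, so it ends at `-1` to avoid the singular point.
    (tendsto_zero_of_hasDerivAt_of_integrableOn_Iic (a := -1)
      (fun x hx => hd x (by rintro rfl; norm_num at hx)) (h2.add h1).integrableOn h3.integrableOn)
  rw [← intervalIntegral.integral_Iic_add_Ioi (b := 0) h1.integrableOn h1.integrableOn,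
    ← intervalIntegral.integral_Iic_add_Ioi (b := 0) h2.integrableOn h2.integrableOn, hL, hR, jump]
  simp only [iteratedDeriv_zero]
  ring

end PiecewiseSmooth

/-! ### Gaussian weights -/

/-- A polynomial times a centred Gaussian function. -/
noncomputable def gaussWeight (c : ℝ) (N : ℕ) (x : ℝ) : ℝ := (1 + |x|) ^ N * Real.exp (-c * x ^ 2)

lemma gaussWeight_nonneg (c : ℝ) (N : ℕ) (x : ℝ) : 0 ≤ gaussWeight c N x := by
  unfold gaussWeight; positivity

lemma pow_mul_gaussWeight (c : ℝ) (M N : ℕ) (x : ℝ) :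
    (1 + |x|) ^ M * gaussWeight c N x = gaussWeight c (M + N) x := by
  unfold gaussWeight; ring

lemma integrable_gaussWeight {c : ℝ} (hc : 0 < c) (N : ℕ) : Integrable (gaussWeight c N) := by
  have : gaussWeight c N = fun x => ∑ k ∈ Finset.range (N + 1),
      N.choose k * ‖x ^ (k : ℝ) * Real.exp (-c * x ^ 2)‖ := by
    ext x
    rw [gaussWeight, add_comm, add_pow, Finset.sum_mul]
    refine Finset.sum_congr rfl fun k _ => ?_
    rw [norm_mul, Real.rpow_natCast, norm_pow, Real.norm_eq_abs, Real.norm_eq_abs, Real.abs_exp]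
    ring
  rw [this]
  exact integrable_finsetSum _ fun k _ => ((integrable_rpow_mul_exp_neg_mul_sq hc
    (by linarith [(Nat.cast_nonneg k : (0 : ℝ) ≤ k)])).norm.const_mul _)

namespace PiecewiseSmooth

variable {φ ψ : ℝ → ℝ}

lemma exists_weight_bound (hφ : PiecewiseSmooth φ) (M : ℕ) : ∃ (C : ℝ) (N : ℕ), 0 ≤ C ∧
    ∀ c x, |φ x| * gaussWeight c M x ≤ C * gaussWeight c N x := by
  obtain ⟨C, N, hC, h⟩ := hφ.exists_pow_bound
  refine ⟨C, N + M, hC, fun c x => ?_⟩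
  rw [← pow_mul_gaussWeight, ← mul_assoc]
  exact mul_le_mul_of_nonneg_right (h x) (gaussWeight_nonneg _ _ _)

lemma integrable_mul (hφ : PiecewiseSmooth φ) {g : ℝ → ℝ} (hg : Continuous g) {c K : ℝ} (hc : 0 < c)
    {M : ℕ} (hK : ∀ x, |g x| ≤ K * gaussWeight c M x) : Integrable fun x => φ x * g x := by
  obtain ⟨C, N, hC, h⟩ := hφ.exists_weight_bound M
  refine ((integrable_gaussWeight hc N).const_mul (K * C)).mono'
    (hφ.measurable.mul hg.measurable).aestronglyMeasurable (ae_of_all _ fun x => ?_)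
  have hK0 : 0 ≤ K := by
    have := (abs_nonneg _).trans (hK 0)
    simpa [gaussWeight] using this
  calc ‖φ x * g x‖ = |φ x| * |g x| := by rw [Real.norm_eq_abs, abs_mul]
    _ ≤ |φ x| * (K * gaussWeight c M x) := mul_le_mul_of_nonneg_left (hK x) (abs_nonneg _)
    _ = K * (|φ x| * gaussWeight c M x) := by ring
    _ ≤ K * (C * gaussWeight c N x) := mul_le_mul_of_nonneg_left (h c x) hK0
    _ = K * C * gaussWeight c N x := by ring

/-- A single majorant serves all kernel values `w` under the Gaussian bound, as differentiation
under the integral sign needs. -/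
lemma exists_prod_bound (hφ : PiecewiseSmooth φ) (hψ : PiecewiseSmooth ψ) {c : ℝ} (hc : 0 < c)
    (M : ℕ) {K : ℝ} (hK : 0 ≤ K) : ∃ B : ℝ × ℝ → ℝ, Integrable B ∧ ∀ z : ℝ × ℝ, ∀ w,
      |w| ≤ K * (gaussWeight c M z.1 * gaussWeight c M z.2) → ‖φ z.1 * ψ z.2 * w‖ ≤ B z := by
  obtain ⟨C, N, hC, h⟩ := hφ.exists_weight_bound M
  obtain ⟨C', N', hC', h'⟩ := hψ.exists_weight_bound M
  refine ⟨fun z => K * ((C * gaussWeight c N z.1) * (C' * gaussWeight c N' z.2)),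
    (((integrable_gaussWeight hc N).const_mul C).mul_prod
      ((integrable_gaussWeight hc N').const_mul C')).const_mul K, fun z w hw => ?_⟩
  calc ‖φ z.1 * ψ z.2 * w‖ = |φ z.1| * |ψ z.2| * |w| := by
        rw [Real.norm_eq_abs, abs_mul, abs_mul]
    _ ≤ |φ z.1| * |ψ z.2| * (K * (gaussWeight c M z.1 * gaussWeight c M z.2)) := by gcongr
    _ = K * ((|φ z.1| * gaussWeight c M z.1) * (|ψ z.2| * gaussWeight c M z.2)) := by ring
    _ ≤ K * ((C * gaussWeight c N z.1) * (C' * gaussWeight c N' z.2)) :=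
      mul_le_mul_of_nonneg_left (mul_le_mul (h c z.1) (h' c z.2)
        (mul_nonneg (abs_nonneg _) (gaussWeight_nonneg _ _ _))
        (mul_nonneg hC (gaussWeight_nonneg _ _ _))) hK

end PiecewiseSmooth

/-! ### The one-dimensional Gaussian kernel -/

/-- The density of the centred Gaussian distribution with variance `v`. -/
noncomputable def heat (v x : ℝ) : ℝ := (√(2 * Real.pi * v))⁻¹ * Real.exp (-x ^ 2 / (2 * v))

lemma continuous_heat (v : ℝ) : Continuous (heat v) := by unfold heat; fun_prop

lemma hasDerivAt_heat (v x : ℝ) : HasDerivAt (heat v) (-(x / v) * heat v x) x := by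
  have h : HasDerivAt (fun x : ℝ => -x ^ 2 / (2 * v)) (-(x / v)) x :=
    (((hasDerivAt_pow 2 x).neg).div_const (2 * v)).congr_deriv (by
      rw [neg_div, ← mul_div_mul_left x v two_ne_zero]; simp)
  exact (h.exp.const_mul _).congr_deriv (by unfold heat; ring)

lemma hasDerivAt_heat_snd (v x : ℝ) : HasDerivAt (fun x => -(x / v) * heat v x)
    ((x ^ 2 / v ^ 2 - 1 / v) * heat v x) x :=
  ((((hasDerivAt_id x).div_const v).neg).mul (hasDerivAt_heat v x)).congr_deriv (by
    simp only [id, Pi.neg_apply]; ring)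

lemma hasDerivAt_heat_variance {v : ℝ} (hv : 0 < v) (x : ℝ) :
    HasDerivAt (fun v => heat v x) (1 / 2 * ((x ^ 2 / v ^ 2 - 1 / v) * heat v x)) v := by
  have hπ := Real.pi_pos
  have hpos : 0 < 2 * Real.pi * v := by positivity
  have h1 : HasDerivAt (fun v : ℝ => (√(2 * Real.pi * v))⁻¹)
      (-(1 / (2 * v)) * (√(2 * Real.pi * v))⁻¹) v := by
    refine ((((hasDerivAt_id v).const_mul (2 * Real.pi)).sqrt hpos.ne').inv
      (Real.sqrt_pos.2 hpos).ne').congr_deriv ?_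
    have h0 := (Real.sqrt_pos.2 hpos).ne'
    have hs := Real.sq_sqrt hpos.le
    simp only [id]
    rw [hs]
    field_simp
  have h2 : HasDerivAt (fun v : ℝ => -x ^ 2 / (2 * v)) (x ^ 2 / (2 * v ^ 2)) v :=
    ((hasDerivAt_const v (-x ^ 2)).div ((hasDerivAt_id v).const_mul 2) (by simpa using hv.ne')).congr_deriv
      (by simp only [id]; field_simp; ring)
  refine (h1.mul h2.exp).congr_deriv ?_
  simp only [heat]
  ring

lemma heat_le {v₀ v : ℝ} (hv₀ : 0 < v₀) (hv : v ∈ Ioo (v₀ / 2) (2 * v₀)) (x : ℝ) :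
    |heat v x| ≤ (√(Real.pi * v₀))⁻¹ * Real.exp (-(1 / (4 * v₀)) * x ^ 2) := by
  have hπ := Real.pi_pos
  have hv0 : 0 < v := by linarith [hv.1]
  have h0 : 0 ≤ heat v x := by unfold heat; positivity
  rw [abs_of_nonneg h0, heat]
  refine mul_le_mul (inv_anti₀ (by positivity) (Real.sqrt_le_sqrt ?_)) (Real.exp_le_exp.2 ?_)
    (Real.exp_pos _).le (by positivity)
  · nlinarith [hv.1]
  · rw [neg_div, neg_mul, neg_le_neg_iff, one_div_mul_eq_div]
    exact div_le_div_of_nonneg_left (sq_nonneg x) (by positivity) (by linarith [hv.2])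

lemma exists_heat_bound {v₀ : ℝ} (hv₀ : 0 < v₀) : ∃ K : ℝ, ∀ v ∈ Ioo (v₀ / 2) (2 * v₀), ∀ x,
    |heat v x| ≤ K * gaussWeight (1 / (4 * v₀)) 2 x ∧
    |-(x / v) * heat v x| ≤ K * gaussWeight (1 / (4 * v₀)) 2 x ∧
    |(x ^ 2 / v ^ 2 - 1 / v) * heat v x| ≤ K * gaussWeight (1 / (4 * v₀)) 2 x := by
  set A := (√(Real.pi * v₀))⁻¹
  have hA : 0 ≤ A := by positivity
  set d := 2 / v₀
  have hd : 0 < d := by positivity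
  refine ⟨(1 + d + d ^ 2) * A, fun v hv x => ?_⟩
  have hv0 : 0 < v := by linarith [hv.1]
  have hvd : 1 / v ≤ d := by
    rw [div_le_div_iff₀ hv0 hv₀]; linarith [hv.1]
  have hvd0 : 0 ≤ 1 / v := by positivity
  have key : ∀ a, |a| ≤ (1 + d + d ^ 2) * (1 + |x|) ^ 2 →
      |a * heat v x| ≤ (1 + d + d ^ 2) * A * gaussWeight (1 / (4 * v₀)) 2 x := fun a ha => by
    rw [abs_mul]
    calc _ ≤ ((1 + d + d ^ 2) * (1 + |x|) ^ 2) * (A * Real.exp (-(1 / (4 * v₀)) * x ^ 2)) :=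
          mul_le_mul ha (heat_le hv₀ hv x) (abs_nonneg _) (by positivity)
      _ = _ := by unfold gaussWeight; ring
  have hx := abs_nonneg x
  have e1 : 1 ≤ (1 + |x|) ^ 2 := by nlinarith
  have e2 : |x| ≤ (1 + |x|) ^ 2 := by nlinarith
  have e3 : |x| ^ 2 ≤ (1 + |x|) ^ 2 := by nlinarith
  have hd2 : (1 / v) ^ 2 ≤ d ^ 2 := pow_le_pow_left₀ hvd0 hvd 2
  refine ⟨by simpa using key 1 (by rw [abs_one]; nlinarith [sq_nonneg d]), key _ ?_, key _ ?_⟩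
  · rw [abs_neg, div_eq_mul_one_div, abs_mul, abs_of_nonneg hvd0]
    calc |x| * (1 / v) ≤ (1 + |x|) ^ 2 * d := by gcongr
      _ ≤ _ := by nlinarith [sq_nonneg d, mul_nonneg (sq_nonneg d) (sq_nonneg (1 + |x|))]
  · calc |x ^ 2 / v ^ 2 - 1 / v| ≤ |x ^ 2 / v ^ 2| + |1 / v| := abs_sub _ _
      _ = |x| ^ 2 * (1 / v) ^ 2 + 1 / v := by
        rw [abs_of_nonneg hvd0, abs_of_nonneg (by positivity), sq_abs]; ring
      _ ≤ (1 + |x|) ^ 2 * d ^ 2 + d * (1 + |x|) ^ 2 := by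
        gcongr
        nlinarith
      _ ≤ _ := by nlinarith

/-- The expectation of `φ` under the centred Gaussian distribution with variance `v`. -/
noncomputable def heatMean (φ : ℝ → ℝ) (v : ℝ) : ℝ := ∫ x, φ x * heat v x

/-- The heat equation `∂ᵥ h = ½ ∂ₓ² h` and two integrations by parts. The jump of `φ` itself meets
`∂ₓ h`, which is zero at the origin, so only the jump of `φ'` survives. -/
lemma hasDerivAt_heatMean {φ : ℝ → ℝ} (hφ : PiecewiseSmooth φ) {v : ℝ} (hv : 0 < v) :
    HasDerivAt (heatMean φ)
      (1 / 2 * (heatMean (deriv (deriv φ)) v + jump 1 φ * (√(2 * Real.pi * v))⁻¹)) v := by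
  obtain ⟨K, hK⟩ := exists_heat_bound hv
  have hc : 0 < 1 / (4 * v) := by positivity
  have hs : Ioo (v / 2) (2 * v) ∈ 𝓝 v := isOpen_Ioo.mem_nhds ⟨by linarith, by linarith⟩
  have hvs : v ∈ Ioo (v / 2) (2 * v) := mem_of_mem_nhds hs
  have c0 := continuous_heat v
  have c1 : Continuous fun x => -(x / v) * heat v x := by fun_prop
  have c2 : Continuous fun x => (x ^ 2 / v ^ 2 - 1 / v) * heat v x := by fun_prop
  have b0 := fun x => (hK v hvs x).1
  have b1 := fun x => (hK v hvs x).2.1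
  have b2 := fun x => (hK v hvs x).2.2
  obtain ⟨C, N, hC, hCN⟩ := hφ.exists_weight_bound 2
  have hW := (integrable_gaussWeight hc N).const_mul (K * C)
  have hK0 : 0 ≤ K := by
    have := (abs_nonneg _).trans (b0 0)
    simpa [gaussWeight] using this
  have main := (hasDerivAt_integral_of_dominated_loc_of_deriv_le (μ := volume) (x₀ := v)
    (F := fun v x => φ x * heat v x)
    (F' := fun v x => φ x * (1 / 2 * ((x ^ 2 / v ^ 2 - 1 / v) * heat v x)))
    (bound := fun x => K * C * gaussWeight (1 / (4 * v)) N x) hs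
    (Eventually.of_forall fun w =>
      (hφ.measurable.mul (continuous_heat w).measurable).aestronglyMeasurable)
    (hφ.integrable_mul c0 hc b0)
    (hφ.measurable.mul (c2.measurable.const_mul (1 / 2))).aestronglyMeasurable
    (ae_of_all _ fun x w hw => ?_) hW
    (ae_of_all _ fun x w hw =>
      (hasDerivAt_heat_variance (by linarith [hw.1]) x).const_mul (φ x))).2
  · refine main.congr_deriv ?_
    have i1 := hφ.integral_mul_deriv (hasDerivAt_heat_snd v) (hφ.integrable_mul c2 hc b2)
      (hφ.deriv.integrable_mul c1 hc b1) (hφ.integrable_mul c1 hc b1)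
    have i2 := hφ.deriv.integral_mul_deriv (hasDerivAt_heat v) (hφ.deriv.integrable_mul c1 hc b1)
      (hφ.deriv.deriv.integrable_mul c0 hc b0) (hφ.deriv.integrable_mul c0 hc b0)
    have : ∀ x, φ x * (1 / 2 * ((x ^ 2 / v ^ 2 - 1 / v) * heat v x)) =
        1 / 2 * (φ x * ((x ^ 2 / v ^ 2 - 1 / v) * heat v x)) := fun x => by ring
    simp_rw [this]
    rw [integral_const_mul, i1, i2, ← jump_succ, heatMean]
    simp [heat]
  · have h2 := (hK w hw x).2.2
    calc ‖φ x * (1 / 2 * ((x ^ 2 / w ^ 2 - 1 / w) * heat w x))‖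
        = 1 / 2 * (|φ x| * |(x ^ 2 / w ^ 2 - 1 / w) * heat w x|) := by
          rw [Real.norm_eq_abs, abs_mul, abs_mul (1 / 2), abs_of_pos (by norm_num : (0 : ℝ) < 1 / 2)]
          ring
      _ ≤ 1 * (|φ x| * (K * gaussWeight (1 / (4 * v)) 2 x)) := by
          gcongr
          norm_num
      _ = K * (|φ x| * gaussWeight (1 / (4 * v)) 2 x) := by ring
      _ ≤ K * (C * gaussWeight (1 / (4 * v)) N x) := mul_le_mul_of_nonneg_left (hCN _ x) hK0
      _ = _ := by ring

/-! ### The two-dimensional Gaussian kernel -/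

/-- The density of the centred Gaussian distribution on the plane with covariance matrix
`!![1, s; s, 1]`. -/
noncomputable def binormal (s x y : ℝ) : ℝ :=
  (2 * Real.pi * √(1 - s ^ 2))⁻¹ * Real.exp (-(x ^ 2 - 2 * s * x * y + y ^ 2) / (2 * (1 - s ^ 2)))

/-- The partial derivative of `binormal s` in the first coordinate. -/
noncomputable def binormalFst (s x y : ℝ) : ℝ := -((x - s * y) / (1 - s ^ 2)) * binormal s x y

/-- The mixed second derivative of `binormal s`. -/
noncomputable def binormalMixed (s x y : ℝ) : ℝ :=
  (s / (1 - s ^ 2) + (x - s * y) * (y - s * x) / (1 - s ^ 2) ^ 2) * binormal s x y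

lemma binormal_comm (s x y : ℝ) : binormal s x y = binormal s y x := by
  unfold binormal; ring_nf

lemma continuous_binormal (s : ℝ) : Continuous fun z : ℝ × ℝ => binormal s z.1 z.2 := by
  unfold binormal; fun_prop

lemma continuous_binormalFst (s : ℝ) : Continuous fun z : ℝ × ℝ => binormalFst s z.1 z.2 := by
  unfold binormalFst binormal; fun_prop

lemma continuous_binormalMixed (s : ℝ) :
    Continuous fun z : ℝ × ℝ => binormalMixed s z.1 z.2 := by
  unfold binormalMixed binormal; fun_prop

lemma one_sub_sq_pos {s : ℝ} (hs : |s| < 1) : 0 < 1 - s ^ 2 := by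
  have := (sq_lt_one_iff_abs_lt_one s).2 hs
  linarith

lemma hasDerivAt_binormal_fst {s : ℝ} (hs : |s| < 1) (x y : ℝ) :
    HasDerivAt (fun x => binormal s x y) (binormalFst s x y) x := by
  have hD := one_sub_sq_pos hs
  have h : HasDerivAt (fun x : ℝ => -(x ^ 2 - 2 * s * x * y + y ^ 2) / (2 * (1 - s ^ 2)))
      (-((x - s * y) / (1 - s ^ 2))) x := by
    refine ((((((hasDerivAt_pow 2 x).sub (((hasDerivAt_id x).const_mul (2 * s)).mul_const y)).add_const
      (y ^ 2))).neg).div_const (2 * (1 - s ^ 2))).congr_deriv ?_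
    field_simp
    norm_num
    ring
  exact (h.exp.const_mul _).congr_deriv (by unfold binormalFst binormal; ring)

lemma hasDerivAt_binormal_snd {s : ℝ} (hs : |s| < 1) (x y : ℝ) :
    HasDerivAt (fun y => binormal s x y) (binormalFst s y x) y := by
  simp_rw [binormal_comm s x]
  exact hasDerivAt_binormal_fst hs y x

lemma hasDerivAt_binormalFst_snd {s : ℝ} (hs : |s| < 1) (x y : ℝ) :
    HasDerivAt (fun y => binormalFst s x y) (binormalMixed s x y) y := by
  have hD := one_sub_sq_pos hs
  have h : HasDerivAt (fun y : ℝ => -((x - s * y) / (1 - s ^ 2))) (s / (1 - s ^ 2)) y :=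
    (((((hasDerivAt_id y).const_mul s).const_sub x).div_const (1 - s ^ 2)).neg).congr_deriv (by ring)
  refine (h.mul (hasDerivAt_binormal_snd hs x y)).congr_deriv ?_
  rw [binormalMixed, binormalFst, binormal_comm s y x]
  generalize 1 - s ^ 2 = D
  ring

/-- The Gaussian kernel solves `∂ₛ p = ∂ₓ ∂ᵧ p`. -/
lemma hasDerivAt_binormal_correlation {s : ℝ} (hs : |s| < 1) (x y : ℝ) :
    HasDerivAt (fun s => binormal s x y) (binormalMixed s x y) s := by
  have hD := one_sub_sq_pos hs
  have hπ := Real.pi_pos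
  have hDd : HasDerivAt (fun s : ℝ => 1 - s ^ 2) (-(2 * s)) s :=
    ((hasDerivAt_pow 2 s).const_sub 1).congr_deriv (by norm_num)
  have h1 : HasDerivAt (fun s : ℝ => (2 * Real.pi * √(1 - s ^ 2))⁻¹)
      (s / (1 - s ^ 2) * (2 * Real.pi * √(1 - s ^ 2))⁻¹) s := by
    have h0 := (Real.sqrt_pos.2 hD).ne'
    refine (((hDd.sqrt hD.ne').const_mul (2 * Real.pi)).inv (by positivity)).congr_deriv ?_
    rw [mul_pow, Real.sq_sqrt hD.le]
    field_simp
  have h2 : HasDerivAt (fun s : ℝ => -(x ^ 2 - 2 * s * x * y + y ^ 2) / (2 * (1 - s ^ 2)))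
      ((x - s * y) * (y - s * x) / (1 - s ^ 2) ^ 2) s := by
    have hn : HasDerivAt (fun s : ℝ => -(x ^ 2 - 2 * s * x * y + y ^ 2)) (2 * x * y) s :=
      ((((((hasDerivAt_id s).const_mul 2).mul_const x).mul_const y).const_sub (x ^ 2)).add_const
        (y ^ 2)).neg.congr_deriv (by ring)
    refine (hn.div (hDd.const_mul 2) (by positivity)).congr_deriv ?_
    field_simp
    ring
  refine (h1.mul h2.exp).congr_deriv ?_
  unfold binormalMixed binormal
  ring

/-- `x² - 2sxy + y² ≥ (1 - ρ)(x² + y²)`, and dividing by `1 - s² ≤ 1` only helps. The bound is a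
product, uniform in `|s| ≤ ρ`. -/
lemma binormal_le {ρ s : ℝ} (hρ : ρ < 1) (hs : |s| ≤ ρ) (x y : ℝ) :
    |binormal s x y| ≤ (2 * Real.pi * √(1 - ρ ^ 2))⁻¹ *
      (Real.exp (-((1 - ρ) / 2) * x ^ 2) * Real.exp (-((1 - ρ) / 2) * y ^ 2)) := by
  have hπ := Real.pi_pos
  have hρ0 : 0 ≤ ρ := (abs_nonneg s).trans hs
  have hD := one_sub_sq_pos (hs.trans_lt hρ)
  have hd : 0 < 1 - ρ ^ 2 := by nlinarith
  have hsρ : s ^ 2 ≤ ρ ^ 2 := sq_le_sq.2 (by rwa [abs_of_nonneg hρ0])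
  have h0 : 0 ≤ binormal s x y := by unfold binormal; positivity
  rw [abs_of_nonneg h0, binormal, ← Real.exp_add]
  refine mul_le_mul ?_ (Real.exp_le_exp.2 ?_) (Real.exp_pos _).le (by positivity)
  · exact inv_anti₀ (by positivity) (by gcongr)
  · rw [div_le_iff₀ (by positivity)]
    have h1 : |s * (2 * (x * y))| ≤ ρ * (x ^ 2 + y ^ 2) := by
      rw [abs_mul]
      refine mul_le_mul hs ?_ (abs_nonneg _) hρ0
      rw [abs_le]; constructor <;> nlinarith [sq_nonneg (x - y), sq_nonneg (x + y)]
    have h2 := (abs_le.1 h1).2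
    have h3 : 0 ≤ (1 - ρ) * (x ^ 2 + y ^ 2) * s ^ 2 :=
      mul_nonneg (mul_nonneg (by linarith) (by positivity)) (sq_nonneg s)
    nlinarith

lemma exists_binormal_bound {ρ : ℝ} (hρ : ρ < 1) : ∃ K : ℝ, 0 ≤ K ∧ ∀ s, |s| ≤ ρ → ∀ x y,
    |binormal s x y| ≤ K * (gaussWeight ((1 - ρ) / 2) 2 x * gaussWeight ((1 - ρ) / 2) 2 y) ∧
    |binormalFst s x y| ≤ K * (gaussWeight ((1 - ρ) / 2) 2 x * gaussWeight ((1 - ρ) / 2) 2 y) ∧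
    |binormalMixed s x y| ≤ K * (gaussWeight ((1 - ρ) / 2) 2 x * gaussWeight ((1 - ρ) / 2) 2 y) := by
  have hπ := Real.pi_pos
  set A := (2 * Real.pi * √(1 - ρ ^ 2))⁻¹ with hA'
  have hA : 0 ≤ A := by positivity
  -- The absolute value makes the constant nonnegative before an `s` with `|s| ≤ ρ` forces `0 ≤ ρ`.
  set d := 1 / |1 - ρ ^ 2| with hd'
  have hd : 0 ≤ d := by positivity
  refine ⟨(1 + d + d ^ 2) * A, by positivity, fun s hs x y => ?_⟩
  have hρ0 : 0 ≤ ρ := (abs_nonneg s).trans hs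
  have hD := one_sub_sq_pos (hs.trans_lt hρ)
  have hdp : 0 < 1 - ρ ^ 2 := by nlinarith
  have hsρ : s ^ 2 ≤ ρ ^ 2 := sq_le_sq.2 (by rwa [abs_of_nonneg hρ0])
  have hs1 : |s| ≤ 1 := hs.trans hρ.le
  have hDd : 1 / (1 - s ^ 2) ≤ d := by
    rw [hd', abs_of_pos hdp]
    exact one_div_le_one_div_of_le hdp (by linarith)
  have hD0 : 0 ≤ 1 / (1 - s ^ 2) := by positivity
  have hx := abs_nonneg x
  have hy := abs_nonneg y
  set P := (1 + |x|) ^ 2 * (1 + |y|) ^ 2 with hP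
  have key : ∀ a, |a| ≤ (1 + d + d ^ 2) * P → |a * binormal s x y| ≤ (1 + d + d ^ 2) * A *
      (gaussWeight ((1 - ρ) / 2) 2 x * gaussWeight ((1 - ρ) / 2) 2 y) := fun a ha => by
    rw [abs_mul]
    calc _ ≤ ((1 + d + d ^ 2) * P) * (A *
          (Real.exp (-((1 - ρ) / 2) * x ^ 2) * Real.exp (-((1 - ρ) / 2) * y ^ 2))) :=
          mul_le_mul ha (binormal_le hρ hs x y) (abs_nonneg _) (by positivity)
      _ = _ := by unfold gaussWeight; ring
  have hxy : 0 ≤ |x| * |y| := by positivity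
  have hPsq : P = (1 + |x| + |y| + |x| * |y|) ^ 2 := by rw [hP]; ring
  have e1 : 1 ≤ P := by rw [hPsq]; nlinarith
  have e2 : |x| + |y| ≤ P := by rw [hPsq]; nlinarith
  have e3 : (|x| + |y|) ^ 2 ≤ P := by
    rw [hPsq]; exact pow_le_pow_left₀ (by positivity) (by linarith) 2
  have f1 : |x - s * y| ≤ |x| + |y| := by
    refine (abs_sub _ _).trans ?_
    rw [abs_mul]; nlinarith
  have f2 : |y - s * x| ≤ |x| + |y| := by
    refine (abs_sub _ _).trans ?_
    rw [abs_mul]; nlinarith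
  have hd2 : (1 / (1 - s ^ 2)) ^ 2 ≤ d ^ 2 := pow_le_pow_left₀ hD0 hDd 2
  have hdP : 0 ≤ d * P := by positivity
  have hd2P : 0 ≤ d ^ 2 * P := by positivity
  refine ⟨by simpa using key 1 (by rw [abs_one]; nlinarith [sq_nonneg d]), key _ ?_, key _ ?_⟩
  · rw [abs_neg, div_eq_mul_one_div, abs_mul, abs_of_nonneg hD0]
    calc |x - s * y| * (1 / (1 - s ^ 2)) ≤ P * d :=
          mul_le_mul (f1.trans e2) hDd hD0 (by positivity)
      _ ≤ _ := by nlinarith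
  · calc |s / (1 - s ^ 2) + (x - s * y) * (y - s * x) / (1 - s ^ 2) ^ 2|
        ≤ |s / (1 - s ^ 2)| + |(x - s * y) * (y - s * x) / (1 - s ^ 2) ^ 2| := abs_add_le _ _
      _ = |s| * (1 / (1 - s ^ 2)) + |x - s * y| * |y - s * x| * (1 / (1 - s ^ 2)) ^ 2 := by
        rw [abs_div, abs_div, abs_mul, abs_of_pos hD, abs_of_pos (pow_pos hD 2)]
        generalize 1 - s ^ 2 = D
        ring
      _ ≤ 1 * d + (|x| + |y|) * (|x| + |y|) * d ^ 2 := by gcongr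
      _ ≤ _ := by nlinarith

/-- The expectation of `φ u * φ v` for standard Gaussian `u` and `v` with correlation `s`, written
with the density. -/
noncomputable def gaussPair (φ : ℝ → ℝ) (s : ℝ) : ℝ :=
  ∫ z : ℝ × ℝ, φ z.1 * φ z.2 * binormal s z.1 z.2

namespace PiecewiseSmooth

variable {φ ψ : ℝ → ℝ}

lemma integrable_prod_mul (hφ : PiecewiseSmooth φ) (hψ : PiecewiseSmooth ψ) {c K : ℝ} (hc : 0 < c)
    (hK : 0 ≤ K) {k : ℝ → ℝ → ℝ} (hk : Continuous fun z : ℝ × ℝ => k z.1 z.2)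
    (hb : ∀ x y, |k x y| ≤ K * (gaussWeight c 2 x * gaussWeight c 2 y)) :
    Integrable fun z : ℝ × ℝ => φ z.1 * ψ z.2 * k z.1 z.2 := by
  obtain ⟨B, hB, hBz⟩ := hφ.exists_prod_bound hψ hc 2 hK
  exact hB.mono' (((hφ.measurable.comp measurable_fst).mul
    (hψ.measurable.comp measurable_snd)).mul hk.measurable).aestronglyMeasurable
    (ae_of_all _ fun z => hBz z _ (hb z.1 z.2))

/-- Integration by parts in `y`, then in `x`. Jump meets jump in the first term; the two mixed terms
coincide because the kernel is symmetric. -/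
lemma integral_binormalMixed (hφ : PiecewiseSmooth φ) {s : ℝ} (hs : |s| < 1) :
    ∫ z : ℝ × ℝ, φ z.1 * φ z.2 * binormalMixed s z.1 z.2 =
      jump 0 φ ^ 2 * binormal s 0 0 + 2 * jump 0 φ * (∫ y, deriv φ y * binormal s 0 y) +
        gaussPair (deriv φ) s := by
  obtain ⟨K, hK0, hK⟩ := exists_binormal_bound hs
  have hK := hK s le_rfl
  set c := (1 - |s|) / 2
  have hc : 0 < c := by simp only [c]; linarith
  have c0 := continuous_binormal s
  have c1 := continuous_binormalFst s
  have c2 := continuous_binormalMixed s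
  have I1 : ∀ {φ : ℝ → ℝ}, PiecewiseSmooth φ → ∀ {k : ℝ → ℝ → ℝ},
      (Continuous fun z : ℝ × ℝ => k z.1 z.2) →
      (∀ x y, |k x y| ≤ K * (gaussWeight c 2 x * gaussWeight c 2 y)) →
      (∀ x, Integrable fun y => φ y * k x y) ∧ ∀ y, Integrable fun x => φ x * k x y := by
    intro φ hφ k hk hb
    refine ⟨fun x => hφ.integrable_mul (c := c) (K := K * gaussWeight c 2 x) (M := 2)
      (hk.comp (by fun_prop : Continuous fun y : ℝ => (x, y))) hc fun y => ?_,
      fun y => hφ.integrable_mul (c := c) (K := K * gaussWeight c 2 y) (M := 2)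
      (hk.comp (by fun_prop : Continuous fun x : ℝ => (x, y))) hc fun x => ?_⟩
    · exact (hb x y).trans_eq (by ring)
    · exact (hb x y).trans_eq (by ring)
  have b0 := fun x y => (hK x y).1
  have b1 := fun x y => (hK x y).2.1
  have b2 := fun x y => (hK x y).2.2
  have s1 : ∀ x, ∫ y, φ y * binormalMixed s x y =
      -jump 0 φ * binormalFst s x 0 - ∫ y, deriv φ y * binormalFst s x y := fun x =>
    hφ.integral_mul_deriv (hasDerivAt_binormalFst_snd hs x) ((I1 hφ c2 b2).1 x)
      ((I1 hφ.deriv c1 b1).1 x) ((I1 hφ c1 b1).1 x)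
  have s2 : ∀ y, ∫ x, φ x * binormalFst s x y =
      -jump 0 φ * binormal s 0 y - ∫ x, deriv φ x * binormal s x y := fun y =>
    hφ.integral_mul_deriv (fun x => hasDerivAt_binormal_fst hs x y) ((I1 hφ c1 b1).2 y)
      ((I1 hφ.deriv c0 b0).2 y) ((I1 hφ c0 b0).2 y)
  have P2 := hφ.integrable_prod_mul hφ hc hK0 c2 b2
  have P1 := hφ.integrable_prod_mul hφ.deriv hc hK0 c1 b1
  have P0 := hφ.deriv.integrable_prod_mul hφ.deriv hc hK0 c0 b0
  have Q1 : ∫ z : ℝ × ℝ, φ z.1 * deriv φ z.2 * binormalFst s z.1 z.2 =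
      -jump 0 φ * (∫ y, deriv φ y * binormal s 0 y) - gaussPair (deriv φ) s := by
    have e : ∀ y, ∫ x, φ x * deriv φ y * binormalFst s x y =
        -jump 0 φ * (deriv φ y * binormal s 0 y) -
          ∫ x, deriv φ x * deriv φ y * binormal s x y := fun y => by
      simp_rw [mul_comm (φ _) (deriv φ y), mul_comm (deriv φ _) (deriv φ y), mul_assoc]
      rw [integral_const_mul, integral_const_mul, s2 y]
      ring
    rw [gaussPair, Measure.volume_eq_prod, integral_prod_symm _ P1, integral_prod_symm _ P0]
    simp only [e]
    rw [integral_sub (((I1 hφ.deriv c0 b0).1 0).const_mul _) P0.integral_prod_right,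
      integral_const_mul]
  have e2 : ∀ x, ∫ y, φ x * φ y * binormalMixed s x y =
      -jump 0 φ * (φ x * binormalFst s x 0) -
        ∫ y, φ x * deriv φ y * binormalFst s x y := fun x => by
    simp_rw [mul_assoc (φ x)]
    rw [integral_const_mul, integral_const_mul, s1 x]
    ring
  rw [Measure.volume_eq_prod, integral_prod _ P2]
  simp only [e2]
  rw [integral_sub (((I1 hφ c1 b1).2 0).const_mul _) P1.integral_prod_left, integral_const_mul, s2 0,
    ← integral_prod _ P1, ← Measure.volume_eq_prod, Q1]
  simp only [fun x => binormal_comm s x 0]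
  ring

end PiecewiseSmooth

lemma two_pi_mul_sqrt (v : ℝ) : 2 * Real.pi * √v = √(2 * Real.pi) * √(2 * Real.pi * v) := by
  have hπ : 0 ≤ 2 * Real.pi := by positivity
  rw [Real.sqrt_mul hπ v, ← mul_assoc, Real.mul_self_sqrt hπ]

lemma binormal_zero_left (s y : ℝ) :
    binormal s 0 y = (√(2 * Real.pi))⁻¹ * heat (1 - s ^ 2) y := by
  rw [binormal, heat, two_pi_mul_sqrt, mul_inv, mul_assoc]
  congr 4
  ring

/-- Price's theorem for a function with a jump at zero. -/
lemma hasDerivAt_gaussPair {φ : ℝ → ℝ} (hφ : PiecewiseSmooth φ) {s : ℝ} (hs : |s| < 1) :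
    HasDerivAt (gaussPair φ) (jump 0 φ ^ 2 * (2 * Real.pi * √(1 - s ^ 2))⁻¹ +
      2 * jump 0 φ * (√(2 * Real.pi))⁻¹ * heatMean (deriv φ) (1 - s ^ 2) +
        gaussPair (deriv φ) s) s := by
  -- The margin between `|s|` and `ρ` gives a neighbourhood of `s` with one majorant.
  obtain ⟨ρ, hsρ, hρ⟩ := exists_between hs
  obtain ⟨K, hK0, hK⟩ := exists_binormal_bound hρ
  have hc : 0 < (1 - ρ) / 2 := by linarith
  obtain ⟨B, hB, hBz⟩ := hφ.exists_prod_bound hφ hc 2 hK0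
  have hmem : {s : ℝ | |s| < ρ} ∈ 𝓝 s := (isOpen_lt continuous_abs continuous_const).mem_nhds hsρ
  have hm : Measurable fun z : ℝ × ℝ => φ z.1 * φ z.2 :=
    (hφ.measurable.comp measurable_fst).mul (hφ.measurable.comp measurable_snd)
  have main := (hasDerivAt_integral_of_dominated_loc_of_deriv_le (μ := volume) (x₀ := s)
    (F := fun s (z : ℝ × ℝ) => φ z.1 * φ z.2 * binormal s z.1 z.2)
    (F' := fun s (z : ℝ × ℝ) => φ z.1 * φ z.2 * binormalMixed s z.1 z.2) (bound := B) hmem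
    (Eventually.of_forall fun w => (hm.mul (continuous_binormal w).measurable).aestronglyMeasurable)
    (hφ.integrable_prod_mul hφ hc hK0 (continuous_binormal s) fun x y => (hK s hsρ.le x y).1)
    (hm.mul (continuous_binormalMixed s).measurable).aestronglyMeasurable
    (ae_of_all _ fun z w hw => hBz z _ (hK w (le_of_lt hw) z.1 z.2).2.2) hB
    (ae_of_all _ fun z w hw =>
      (hasDerivAt_binormal_correlation ((show |w| < ρ from hw).trans hρ) z.1 z.2).const_mul _)).2
  refine main.congr_deriv ?_
  rw [hφ.integral_binormalMixed hs, heatMean]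
  congr 2
  · simp [binormal]
  · rw [mul_assoc (2 * jump 0 φ), ← integral_const_mul (√(2 * Real.pi))⁻¹]
    congr 1
    refine integral_congr_ae (ae_of_all _ fun y => ?_)
    simp only [binormal_zero_left]
    ring

/-! ### Representation of the dual activation by independent Gaussian variables -/

lemma posSemidef_correlation {s : ℝ} (hs : |s| ≤ 1) :
    (!![1, s; s, 1] : Matrix (Fin 2) (Fin 2) ℝ).PosSemidef := by
  refine Matrix.PosSemidef.of_dotProduct_mulVec_nonneg ?_ fun x => ?_
  · ext i j
    fin_cases i <;> fin_cases j <;> simp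
  · have h := (abs_le.1 hs)
    have e : star x ⬝ᵥ (!![1, s; s, 1] : Matrix (Fin 2) (Fin 2) ℝ).mulVec x =
        (1 + s) / 2 * (x 0 + x 1) ^ 2 + (1 - s) / 2 * (x 0 - x 1) ^ 2 := by
      simp [dotProduct, Matrix.mulVec, Fin.sum_univ_two]; ring
    rw [e]
    exact add_nonneg (mul_nonneg (by linarith) (sq_nonneg _)) (mul_nonneg (by linarith) (sq_nonneg _))

lemma measurable_correlated (s : ℝ) : Measurable fun z : ℝ × ℝ =>
    (!₂[z.1, s * z.1 + √(1 - s ^ 2) * z.2] : EuclideanSpace ℝ (Fin 2)) := by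
  refine (WithLp.measurable_toLp 2 _).comp (measurable_pi_lambda _ fun i => ?_)
  fin_cases i
  · simpa using measurable_fst
  · simp only [Fin.mk_one, Matrix.cons_val_one, Matrix.cons_val_fin_one]; fun_prop

/-- Both characteristic functions agree because `(x₀ + s x₁)² + (1 - s²) x₁² = x₀² + 2 s x₀ x₁ +
x₁²`. This includes `s = ±1`, where there is no density. -/
lemma multivariateGaussian_correlation_eq_map {s : ℝ} (hs : |s| ≤ 1) :
    multivariateGaussian 0 !![1, s; s, 1] = ((gaussianReal 0 1).prod (gaussianReal 0 1)).map
      fun z => (!₂[z.1, s * z.1 + √(1 - s ^ 2) * z.2] : EuclideanSpace ℝ (Fin 2)) := by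
  have hD : 0 ≤ 1 - s ^ 2 := by
    have := (sq_le_one_iff_abs_le_one s).2 hs
    linarith
  have hf := measurable_correlated s
  refine Measure.ext_of_charFun (funext fun x => ?_)
  rw [charFun_multivariateGaussian (posSemidef_correlation hs), charFun_apply,
    integral_map hf.aemeasurable (by fun_prop)]
  have e : ∀ z : ℝ × ℝ, Complex.exp
      (inner ℝ (!₂[z.1, s * z.1 + √(1 - s ^ 2) * z.2] : EuclideanSpace ℝ (Fin 2)) x * Complex.I) =
      Complex.exp ((x 0 + s * x 1 : ℝ) * z.1 * Complex.I) *
        Complex.exp ((√(1 - s ^ 2) * x 1 : ℝ) * z.2 * Complex.I) := fun z => by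
    rw [← Complex.exp_add]
    congr 1
    simp [PiLp.inner_apply, Fin.sum_univ_two]
    ring
  simp_rw [e]
  rw [integral_prod_mul (fun u : ℝ => Complex.exp ((x 0 + s * x 1 : ℝ) * u * Complex.I))
    (fun u : ℝ => Complex.exp ((√(1 - s ^ 2) * x 1 : ℝ) * u * Complex.I)), ← charFun_apply_real,
    ← charFun_apply_real, charFun_gaussianReal, charFun_gaussianReal, ← Complex.exp_add]
  congr 1
  have hsq : ((√(1 - s ^ 2) : ℝ) : ℂ) ^ 2 = 1 - (s : ℂ) ^ 2 := by
    rw [← Complex.ofReal_pow, Real.sq_sqrt hD]; push_cast; ring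
  simp [dotProduct, Matrix.mulVec, Fin.sum_univ_two, mul_pow, hsq]
  ring

/-! ### Moment bounds uniform up to the degenerate endpoints -/

lemma integrable_pow_gaussianReal (N : ℕ) :
    Integrable (fun x : ℝ => (1 + |x|) ^ N) (gaussianReal 0 1) := by
  have h1 : MemLp (fun x : ℝ => x) N (gaussianReal 0 1) := memLp_id_gaussianReal' N (by simp)
  have h : MemLp (fun x : ℝ => 1 + ‖x‖) N (gaussianReal 0 1) := (memLp_const (1 : ℝ)).add h1.norm
  refine h.integrable_norm_pow'.congr (ae_of_all _ fun x => ?_)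
  simp only [Real.norm_eq_abs]
  rw [abs_of_nonneg (by positivity)]

lemma heatMean_eq_integral_gaussianReal (φ : ℝ → ℝ) {v : NNReal} (hv : v ≠ 0) :
    heatMean φ v = ∫ x, φ x ∂(gaussianReal 0 v) := by
  rw [integral_gaussianReal_eq_integral_smul hv, heatMean]
  refine integral_congr_ae (ae_of_all _ fun x => ?_)
  simp only [heat, gaussianPDFReal, smul_eq_mul, sub_zero]
  ring

lemma gaussianReal_eq_map (m : ℝ) {v : ℝ} (hv : 0 ≤ v) :
    gaussianReal m (.mk v hv) = (gaussianReal 0 1).map fun x => m + √v * x := by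
  have h : (fun x => m + √v * x) = (m + ·) ∘ (√v * ·) := rfl
  rw [h, ← Measure.map_map (by fun_prop) (by fun_prop), gaussianReal_map_const_mul,
    gaussianReal_map_const_add]
  congr 1
  · simp
  · ext; simp [Real.sq_sqrt hv]

namespace PiecewiseSmooth

variable {φ : ℝ → ℝ}

lemma heatMean_eq (hφ : PiecewiseSmooth φ) {v : ℝ} (hv : 0 < v) :
    heatMean φ v = ∫ x, φ (√v * x) ∂(gaussianReal 0 1) := by
  have := heatMean_eq_integral_gaussianReal φ (v := .mk v hv.le)
    (fun h => hv.ne' (congrArg NNReal.toReal h))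
  rw [gaussianReal_eq_map, integral_map (by fun_prop) hφ.measurable.aestronglyMeasurable] at this
  simpa using this

lemma exists_heatMean_bound (hφ : PiecewiseSmooth φ) :
    ∃ B, ∀ v, 0 < v → v ≤ 1 → |heatMean φ v| ≤ B := by
  obtain ⟨C, N, hC, h⟩ := hφ.exists_pow_bound
  refine ⟨∫ x, C * (1 + |x|) ^ N ∂(gaussianReal 0 1), fun v hv hv1 => ?_⟩
  rw [hφ.heatMean_eq hv, ← Real.norm_eq_abs]
  refine norm_integral_le_of_norm_le ((integrable_pow_gaussianReal N).const_mul C)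
    (ae_of_all _ fun x => (h _).trans ?_)
  have : |√v * x| ≤ |x| := by
    rw [abs_mul, abs_of_nonneg (Real.sqrt_nonneg v)]
    exact mul_le_of_le_one_left (abs_nonneg x) (Real.sqrt_le_one.2 hv1)
  gcongr

/-- The kernel bounds blow up as `|s| → 1`; in independent variables one integrable majorant works
for all correlations. -/
lemma exists_pair_bound (hφ : PiecewiseSmooth φ) : ∃ B : ℝ × ℝ → ℝ,
    Integrable B ((gaussianReal 0 1).prod (gaussianReal 0 1)) ∧
      ∀ s, |s| ≤ 1 → ∀ z, ‖φ z.1 * φ (s * z.1 + √(1 - s ^ 2) * z.2)‖ ≤ B z := by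
  obtain ⟨C, N, hC, h⟩ := hφ.exists_pow_bound
  refine ⟨fun z => (C * C) * ((1 + |z.1|) ^ (N + N) * (1 + |z.2|) ^ N),
    ((integrable_pow_gaussianReal _).mul_prod (integrable_pow_gaussianReal _)).const_mul _,
    fun s hs z => ?_⟩
  have h1 : |s * z.1 + √(1 - s ^ 2) * z.2| ≤ |z.1| + |z.2| := by
    refine (abs_add_le _ _).trans (add_le_add ?_ ?_)
    · rw [abs_mul]; exact mul_le_of_le_one_left (abs_nonneg _) hs
    · rw [abs_mul, abs_of_nonneg (Real.sqrt_nonneg _)]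
      exact mul_le_of_le_one_left (abs_nonneg _) (Real.sqrt_le_one.2 (by nlinarith [sq_nonneg s]))
  have h2 : 1 + |s * z.1 + √(1 - s ^ 2) * z.2| ≤ (1 + |z.1|) * (1 + |z.2|) := by
    nlinarith [mul_nonneg (abs_nonneg z.1) (abs_nonneg z.2)]
  rw [norm_mul]
  calc ‖φ z.1‖ * ‖φ (s * z.1 + √(1 - s ^ 2) * z.2)‖
      ≤ (C * (1 + |z.1|) ^ N) * (C * ((1 + |z.1|) * (1 + |z.2|)) ^ N) := by
        refine mul_le_mul (h _) ((h _).trans ?_) (norm_nonneg _) (by positivity)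
        gcongr
    _ = _ := by rw [mul_pow]; ring

lemma dual_eq_integral_prod (hφ : PiecewiseSmooth φ) {s : ℝ} (hs : |s| ≤ 1) :
    dual φ s = ∫ z : ℝ × ℝ, φ z.1 * φ (s * z.1 + √(1 - s ^ 2) * z.2)
      ∂((gaussianReal 0 1).prod (gaussianReal 0 1)) := by
  have hf := measurable_correlated s
  have hm := hφ.measurable
  rw [dual, multivariateGaussian_correlation_eq_map hs, integral_map hf.aemeasurable
    (Measurable.aestronglyMeasurable (by fun_prop))]
  simp

lemma exists_dual_bound (hφ : PiecewiseSmooth φ) : ∃ B, ∀ s, |s| ≤ 1 → |dual φ s| ≤ B := by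
  obtain ⟨B, hB, h⟩ := hφ.exists_pair_bound
  refine ⟨∫ z, B z ∂((gaussianReal 0 1).prod (gaussianReal 0 1)), fun s hs => ?_⟩
  rw [hφ.dual_eq_integral_prod hs, ← Real.norm_eq_abs]
  exact norm_integral_le_of_norm_le hB (ae_of_all _ (h s hs))

/-- Given `u = x`, the second variable has law `N(sx, 1 - s²)`; completing the square factors the
joint density accordingly. -/
lemma dual_eq_gaussPair (hφ : PiecewiseSmooth φ) {s : ℝ} (hs : |s| < 1) :
    dual φ s = gaussPair φ s := by
  have hD := one_sub_sq_pos hs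
  have hπ := Real.pi_pos
  have hm := hφ.measurable
  obtain ⟨B, hB, hBz⟩ := hφ.exists_pair_bound
  have hI : Integrable (fun z : ℝ × ℝ => φ z.1 * φ (s * z.1 + √(1 - s ^ 2) * z.2))
      ((gaussianReal 0 1).prod (gaussianReal 0 1)) :=
    hB.mono' (Measurable.aestronglyMeasurable (by fun_prop)) (ae_of_all _ (hBz s hs.le))
  obtain ⟨K, hK0, hK⟩ := exists_binormal_bound hs
  have hJ := hφ.integrable_prod_mul hφ (by linarith : 0 < (1 - |s|) / 2) hK0
    (continuous_binormal s) fun x y => (hK s le_rfl x y).1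
  rw [hφ.dual_eq_integral_prod hs.le, integral_prod _ hI, gaussPair, Measure.volume_eq_prod,
    integral_prod _ hJ, integral_gaussianReal_eq_integral_smul one_ne_zero]
  refine integral_congr_ae (ae_of_all _ fun x => ?_)
  have hv : NNReal.mk (1 - s ^ 2) hD.le ≠ 0 := fun h => hD.ne' (congrArg NNReal.toReal h)
  have e1 : ∫ y, φ (s * x + √(1 - s ^ 2) * y) ∂(gaussianReal 0 1) =
      ∫ y, gaussianPDFReal (s * x) (.mk (1 - s ^ 2) hD.le) y * φ y := by
    have := integral_gaussianReal_eq_integral_smul (μ := s * x) (f := φ) hv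
    rw [gaussianReal_eq_map, integral_map (by fun_prop) hm.aestronglyMeasurable] at this
    exact this
  simp only [smul_eq_mul]
  rw [integral_const_mul, e1, ← integral_const_mul, ← integral_const_mul]
  refine integral_congr_ae (ae_of_all _ fun y => ?_)
  have e2 : binormal s x y =
      gaussianPDFReal 0 1 x * gaussianPDFReal (s * x) (.mk (1 - s ^ 2) hD.le) y := by
    have h2 : -(x ^ 2 - 2 * s * x * y + y ^ 2) / (2 * (1 - s ^ 2)) =
        -x ^ 2 / 2 + -(y - s * x) ^ 2 / (2 * (1 - s ^ 2)) := by
      field_simp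
      ring
    rw [binormal, two_pi_mul_sqrt, h2, Real.exp_add]
    simp only [gaussianPDFReal, NNReal.coe_one, mul_one, sub_zero, NNReal.coe_mk]
    rw [mul_inv]
    ring
  simp only [e2]
  ring

end PiecewiseSmooth

/-! ### Boundary expansions -/

lemma mul_two_sub_mem {t : ℝ} (ht : t ∈ Ioo (0 : ℝ) 2) : 0 < t * (2 - t) ∧ t * (2 - t) ≤ 1 :=
  ⟨mul_pos ht.1 (by linarith [ht.2]), by nlinarith [sq_nonneg (t - 1)]⟩

lemma inv_sqrt_eq_rpow {v : ℝ} (hv : 0 ≤ v) : (√v)⁻¹ = v ^ (-(1 / 2) : ℝ) := by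
  rw [Real.sqrt_eq_rpow, Real.rpow_neg hv]

lemma isBigO_one_of_bound {f : ℝ → ℝ} {B : ℝ} (h : ∀ t ∈ Ioo (0 : ℝ) 2, |f t| ≤ B) :
    f =O[𝓝[>] (0 : ℝ)] fun _ => (1 : ℝ) := by
  refine Asymptotics.IsBigO.of_bound B ?_
  filter_upwards [mem_nhdsGT_zero] with t ht
  simpa using h t ht

/-- The family runs over all piecewise smooth `φ`, with `φ ↦ φ''` under differentiation. The affine
factor `1 - t` is half the derivative of `t(2 - t)`. -/
lemma PiecewiseSmooth.heatMean_mem_boundaryClass {φ : ℝ → ℝ} (hφ : PiecewiseSmooth φ) :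
    (fun t => heatMean φ (t * (2 - t))) ∈ BoundaryClass (-1) 0 := by
  refine BoundaryClass.of_derivClosed
    {f | ∃ φ, PiecewiseSmooth φ ∧ f = fun t => heatMean φ (t * (2 - t))} ?_ ?_ ⟨φ, hφ, rfl⟩
  · rintro _ ⟨φ, hφ, rfl⟩
    obtain ⟨B, hB⟩ := hφ.exists_heatMean_bound
    exact isBigO_one_of_bound fun t ht => hB _ (mul_two_sub_mem ht).1 (mul_two_sub_mem ht).2
  · rintro _ ⟨φ, hφ, rfl⟩
    refine ⟨_, ⟨_, hφ.deriv.deriv, rfl⟩, _, BoundaryClass.affine_mul 1 (-1)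
      (BoundaryClass.const_mul (jump 1 φ * (√(2 * Real.pi))⁻¹) rpow_neg_half_mul_mem_boundaryClass),
      1, -1, fun t ht => ?_⟩
    have hv := (mul_two_sub_mem ht).1
    have h1 : HasDerivAt (fun t : ℝ => t * (2 - t)) (2 - 2 * t) t :=
      ((hasDerivAt_id t).mul ((hasDerivAt_id t).const_sub 2)).congr_deriv (by simp; ring)
    refine ((hasDerivAt_heatMean hφ hv).comp t h1).congr_deriv ?_
    rw [Real.sqrt_mul (by positivity), mul_inv, inv_sqrt_eq_rpow hv.le]
    ring

lemma abs_mul_one_sub_lt {τ t : ℝ} (hτ : τ = 1 ∨ τ = -1) (ht : t ∈ Ioo (0 : ℝ) 2) :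
    |τ * (1 - t)| < 1 := by
  have h : |τ| = 1 := by rcases hτ with rfl | rfl <;> simp
  rw [abs_mul, h, one_mul, abs_lt]
  constructor <;> linarith [ht.1, ht.2]

lemma PiecewiseSmooth.hasDerivAt_gaussPair_boundary {φ : ℝ → ℝ} (hφ : PiecewiseSmooth φ) {τ : ℝ}
    (hτ : τ = 1 ∨ τ = -1) {t : ℝ} (ht : t ∈ Ioo (0 : ℝ) 2) :
    HasDerivAt (fun t => gaussPair φ (τ * (1 - t)))
      (-τ * gaussPair (deriv φ) (τ * (1 - t)) +
        (-τ * jump 0 φ ^ 2 * (2 * Real.pi)⁻¹ * (t * (2 - t)) ^ (-(1 / 2) : ℝ) +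
        -τ * 2 * jump 0 φ * (√(2 * Real.pi))⁻¹ * heatMean (deriv φ) (t * (2 - t)))) t := by
  have h1 : HasDerivAt (fun t : ℝ => τ * (1 - t)) (-τ) t :=
    (((hasDerivAt_id t).const_sub 1).const_mul τ).congr_deriv (by simp)
  have h2 : 1 - (τ * (1 - t)) ^ 2 = t * (2 - t) := by
    have : τ ^ 2 = 1 := by rcases hτ with rfl | rfl <;> norm_num
    rw [mul_pow, this]; ring
  refine ((hasDerivAt_gaussPair hφ (abs_mul_one_sub_lt hτ ht)).comp t h1).congr_deriv ?_
  rw [h2, mul_inv, inv_sqrt_eq_rpow (mul_two_sub_mem ht).1.le]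
  ring

/-- The same bootstrap with `φ ↦ φ'`, the jump terms of Price's theorem being the errors. -/
lemma PiecewiseSmooth.gaussPair_mem_boundaryClass {φ : ℝ → ℝ} (hφ : PiecewiseSmooth φ) {τ : ℝ}
    (hτ : τ = 1 ∨ τ = -1) : (fun t => gaussPair φ (τ * (1 - t))) ∈ BoundaryClass (-1) 0 := by
  refine BoundaryClass.of_derivClosed
    {f | ∃ φ, PiecewiseSmooth φ ∧ f = fun t => gaussPair φ (τ * (1 - t))} ?_ ?_ ⟨φ, hφ, rfl⟩
  · rintro _ ⟨φ, hφ, rfl⟩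
    obtain ⟨B, hB⟩ := hφ.exists_dual_bound
    refine isBigO_one_of_bound (B := B) fun t ht => ?_
    rw [← hφ.dual_eq_gaussPair (abs_mul_one_sub_lt hτ ht)]
    exact hB _ (abs_mul_one_sub_lt hτ ht).le
  · rintro _ ⟨φ, hφ, rfl⟩
    refine ⟨_, ⟨_, hφ.deriv, rfl⟩, _, BoundaryClass.add
      (BoundaryClass.const_mul (-τ * jump 0 φ ^ 2 * (2 * Real.pi)⁻¹)
        rpow_neg_half_mul_mem_boundaryClass)
      (BoundaryClass.const_mul (-τ * 2 * jump 0 φ * (√(2 * Real.pi))⁻¹)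
        (BoundaryClass.mono le_rfl (by norm_num) hφ.deriv.heatMean_mem_boundaryClass)),
      -τ, 0, fun t ht => (hφ.hasDerivAt_gaussPair_boundary hτ ht).congr_deriv ?_⟩
    ring

/-- Only `m = 0` involves a singular term; each further step integrates the statement for `φ'`. The
constant is chosen before `φ`, so the induction hypothesis applies to `φ'` with the same constant.
-/
theorem exists_gaussPair_expansion (m : ℕ) : ∃ b : ℝ, 0 < b ∧ ∀ φ : ℝ → ℝ, PiecewiseSmooth φ →
    (∀ k : ℕ, k < m → jump k φ = 0) → ∀ τ : ℝ, (τ = 1 ∨ τ = -1) →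
      (fun t => gaussPair φ (τ * (1 - t)) -
        jump m φ ^ 2 * (-τ) ^ (m + 1) * b * t ^ ((m : ℝ) + 1 / 2)) ∈
          BoundaryClass (-1) ((m : ℝ) + 1 / 2) := by
  induction m with
  | zero =>
    -- Near zero `(2π)⁻¹ (t(2 - t))^(-1/2)` behaves like `(2π)⁻¹ 2^(-1/2) t^(-1/2)`, and integration
    -- doubles the coefficient.
    refine ⟨2 ^ (-(1 / 2) : ℝ) / Real.pi, div_pos (by positivity) Real.pi_pos,
      fun φ hφ _ τ hτ => ?_⟩
    have hE := BoundaryClass.add (BoundaryClass.const_mul (-τ)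
      (BoundaryClass.mono le_rfl (by norm_num) (hφ.deriv.gaussPair_mem_boundaryClass hτ)))
      (BoundaryClass.add (BoundaryClass.const_mul (-τ * jump 0 φ ^ 2 * (2 * Real.pi)⁻¹)
        rpow_neg_half_mul_sub_mem_boundaryClass)
      (BoundaryClass.const_mul (-τ * 2 * jump 0 φ * (√(2 * Real.pi))⁻¹)
        (BoundaryClass.mono le_rfl (by norm_num) hφ.deriv.heatMean_mem_boundaryClass)))
    have hβ : ((0 : ℕ) : ℝ) + 1 / 2 = -(1 / 2) + 1 := by norm_num
    rw [hβ]
    refine BoundaryClass.of_hasDerivAt (fun t ht => ?_) hE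
    refine ((hφ.hasDerivAt_gaussPair_boundary hτ ht).sub
      ((Real.hasDerivAt_rpow_const (Or.inl ht.1.ne')).const_mul _)).congr_deriv ?_
    have hπ := Real.pi_pos.ne'
    rw [add_sub_cancel_right]
    field_simp
    ring
  | succ m ih =>
    obtain ⟨b, hb, ih⟩ := ih
    have hm : (0 : ℝ) < m + 1 + 1 / 2 := by positivity
    -- Integrating `t^(m+1/2)` divides by the new exponent; the chain rule supplies one more factor
    -- `-τ`.
    refine ⟨b / (m + 1 + 1 / 2), by positivity, fun φ hφ hj τ hτ => ?_⟩
    have h := BoundaryClass.const_mul (-τ) (ih (deriv φ) hφ.deriv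
      (fun k hk => by rw [← jump_succ]; exact hj _ (by omega)) τ hτ)
    have hβ : ((m + 1 : ℕ) : ℝ) + 1 / 2 = (m : ℝ) + 1 / 2 + 1 := by push_cast; ring
    rw [hβ]
    refine BoundaryClass.of_hasDerivAt (fun t ht => ?_) h
    refine ((hφ.hasDerivAt_gaussPair_boundary hτ ht).sub
      ((Real.hasDerivAt_rpow_const (Or.inl ht.1.ne')).const_mul _)).congr_deriv ?_
    have hm' : (m : ℝ) + 1 / 2 + 1 = m + 1 + 1 / 2 := by ring
    rw [add_sub_cancel_right, hm', hj 0 (by omega), ← jump_succ]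
    generalize t ^ ((m : ℝ) + 1 / 2) = T
    field_simp
    ring

/-- Split an expansion into a polynomial and a part which is `o(t ^ β)`. -/
lemma BoundaryClass.exists_polynomial {β : ℝ} {f : ℝ → ℝ} (hf : f ∈ BoundaryClass (-1) β) :
    ∃ (p : Polynomial ℝ) (q : ℝ → ℝ), ContDiffOn ℝ ∞ q (Ioo 0 2) ∧
      (∀ n : ℕ, iteratedDeriv n q =o[𝓝[>] (0 : ℝ)] fun t : ℝ => t ^ (β - n)) ∧
      ∀ t ∈ Ioo (0 : ℝ) 2, f t = p.eval t + q t := by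
  classical
  obtain ⟨P, ⟨n, a, e, he, hP⟩, r, hr, hPr⟩ := hf (β + 1)
  -- Only finitely many non-integer exponents occur, all strictly above `β`. A `δ` fits in between,
  -- and `O(t^(δ-n))` is then `o(t^(β-n))`.
  obtain ⟨δ, ⟨hδ, hδe⟩⟩ : ∃ δ, δ ∈ Ioo β (β + 1) ∧ ∀ i, e i ∉ range ((↑) : ℤ → ℝ) → δ < e i := by
    refine (Filter.Eventually.and (Ioo_mem_nhdsGT (by linarith)) (eventually_all.2 fun i => ?_) :
      ∀ᶠ δ in 𝓝[>] β, _).exists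
    by_cases h : e i ∈ range ((↑) : ℤ → ℝ)
    · exact Eventually.of_forall fun δ h' => (h' h).elim
    · filter_upwards [Ioo_mem_nhdsGT ((he i).2 h)] with δ hδ _ using hδ.2
  have hq : (fun t => (∑ i, if e i ∈ range ((↑) : ℤ → ℝ) then 0 else a i * t ^ e i) + r t) ∈
      Remainders δ := by
    refine Remainders.add (Remainders.sum Finset.univ fun i _ => ?_) (Remainders.mono hδ.2.le hr)
    by_cases h : e i ∈ range ((↑) : ℤ → ℝ)
    · simpa only [if_pos h] using Remainders.zero_mem δ
    · simpa only [if_neg h] using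
        Remainders.mono (hδe i h).le (Remainders.const_mul (a i) (Remainders.rpow (e i)))
  refine ⟨∑ i, if e i ∈ range ((↑) : ℤ → ℝ) then
      Polynomial.C (a i) * Polynomial.X ^ ⌊e i⌋.toNat else 0, _, hq.1,
    fun n => (hq.2 n).trans_isLittleO (isLittleO_rpow_of_lt (by linarith [hδ.1])), fun t ht => ?_⟩
  rw [hPr t ht, hP t ht, ← add_assoc, Polynomial.eval_finsetSum, ← Finset.sum_add_distrib]
  congr 1
  refine Finset.sum_congr rfl fun i _ => ?_
  split_ifs with h
  · obtain ⟨k, hk⟩ := h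
    -- An integer exponent above `-1` is a natural number, so its term is a genuine monomial.
    have hk0 : (-1 : ℝ) < k := by rw [hk]; exact (he i).1 ⟨k, hk⟩
    have hk1 : (-1 : ℤ) < k := by exact_mod_cast hk0
    lift k to ℕ using (by omega)
    rw [← hk]
    simp
  · simp

end DualActivation

theorem mainTheorem3 (m : ℕ) :
    ∃ b : ℝ, 0 < b ∧
      ∀ φ : ℝ → ℝ, DualActivation.IsActivation φ →
        (∀ k : ℕ, k < m → DualActivation.jump k φ = 0) →
        ∀ τ : ℝ, (τ = 1 ∨ τ = -1) →
          (∃ Q ∈ DualActivation.BoundaryClass (-1) ((m : ℝ) + 1 / 2),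
            ∀ t ∈ Set.Ioo (0 : ℝ) 2,
              DualActivation.dual φ (τ * (1 - t)) =
                DualActivation.jump m φ ^ 2 * (-τ) ^ (m + 1) * b * t ^ ((m : ℝ) + 1 / 2) + Q t) ∧
          (∃ (p : Polynomial ℝ) (q : ℝ → ℝ), ContDiffOn ℝ ∞ q (Set.Ioo 0 2) ∧
            (∀ n : ℕ, iteratedDeriv n q
              =o[𝓝[>] (0 : ℝ)] fun t : ℝ => t ^ ((m : ℝ) + 1 / 2 - n)) ∧
            ∀ t ∈ Set.Ioo (0 : ℝ) 2,
              DualActivation.dual φ (τ * (1 - t)) =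
                DualActivation.jump m φ ^ 2 * (-τ) ^ (m + 1) * b * t ^ ((m : ℝ) + 1 / 2)
                  + p.eval t + q t) := by
  obtain ⟨b, hb, h⟩ := DualActivation.exists_gaussPair_expansion m
  refine ⟨b, hb, fun φ hφ hj τ hτ => ?_⟩
  have hps := hφ.piecewiseSmooth
  have hQ := h φ hps hj τ hτ
  have hd : ∀ t ∈ Set.Ioo (0 : ℝ) 2, DualActivation.dual φ (τ * (1 - t)) =
      DualActivation.gaussPair φ (τ * (1 - t)) := fun t ht =>
    hps.dual_eq_gaussPair (DualActivation.abs_mul_one_sub_lt hτ ht)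
  refine ⟨⟨_, hQ, fun t ht => by rw [hd t ht]; ring⟩, ?_⟩
  obtain ⟨p, q, hq, hqo, hpq⟩ := DualActivation.BoundaryClass.exists_polynomial hQ
  refine ⟨p, q, hq, hqo, fun t ht => ?_⟩
  rw [hd t ht, add_assoc, ← hpq t ht]
  ring
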